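/- There are $n\ge 1$ bidders and $m$ categories; category $j$ has prior probability $p_j\ge 0$ ($\sum_{j=1}^m p_j=1$), and bidder $i$ values category $j$ at $v_{ij}\ge 0$; all these numbers are rational and known. A (pure) signaling scheme maps every category to one signal. For a scheme $f$ and a signal $S$ that it uses, $\Pr[S]=\sum_{j:f(j)=S}p_j$, and the expected welfare of the scheme is $$W(f)=\sum_{S}\Pr[S]\,\max_{i}\mathbf E[v_i\mid S]=\sum_S \max_i\sum_{j:f(j)=S}v_{ij}\,p_j .$$ For an integer $1\le K\le m$, the scheme is $K$-anonymous if each signal that it uses is sent by at least $K$ categories. **Theorem.** For $K$-anonymous signaling with known valuations there is a randomized polynomial-time $\frac{2e}{e-1}$-approximation algorithm for computing a welfare-maximizing signaling scheme. That is, there is a randomized algorithm that, given $(m,n,K,p,v)$ with the numbers written in binary, always halts within a number of bit operations polynomial in the length of the input, always outputs a $K$-anonymous scheme, and whose (random) output $F$ satisfies $$\max_{g\ K\text{-anonymous}} W(g)\;\le\;\frac{2e}{e-1}\;\mathbf E\,[W(F)] .$$ -/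

import Mathlib

/-! ## Randomized random access machines with logarithmic cost -/

namespace RAM

/-- Configuration of a randomized random access machine: registers `reg x`, arrays `mem a`
with cells `mem a i`, the unread part of the random tape (fair coin tosses), and the output tape.
Registers and cells hold natural numbers. -/
structure State where
  reg : ℕ → ℕ
  mem : ℕ → ℕ → ℕ
  coins : List Bool
  out : List ℕ

/-- Arithmetic expressions: constants, registers, array cells (indirect addressing),
addition, truncated subtraction, multiplication, integer division (with `x / 0 = 0`). -/
inductive Expr where
  | lit (k : ℕ) : Expr
  | reg (x : ℕ) : Expr
  | cell (a : ℕ) (i : Expr) : Expr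
  | add (e₁ e₂ : Expr) : Expr
  | sub (e₁ e₂ : Expr) : Expr
  | mul (e₁ e₂ : Expr) : Expr
  | div (e₁ e₂ : Expr) : Expr

/-- The value of an expression. -/
def Expr.eval (s : State) : Expr → ℕ
  | .lit k => k
  | .reg x => s.reg x
  | .cell a i => s.mem a (i.eval s)
  | .add e₁ e₂ => e₁.eval s + e₂.eval s
  | .sub e₁ e₂ => e₁.eval s - e₂.eval s
  | .mul e₁ e₂ => e₁.eval s * e₂.eval s
  | .div e₁ e₂ => e₁.eval s / e₂.eval s

/-- The logarithmic cost of evaluating an expression: every node of the expression costs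
one plus the binary length of its value.
In particular the addresses and the operands of an operation are paid for by their lengths. -/
def Expr.cost (s : State) : Expr → ℕ
  | .lit k => k.size + 1
  | .reg x => (s.reg x).size + 1
  | .cell a i => i.cost s + (s.mem a (i.eval s)).size + 1
  | .add e₁ e₂ => e₁.cost s + e₂.cost s + (e₁.eval s + e₂.eval s).size + 1
  | .sub e₁ e₂ => e₁.cost s + e₂.cost s + (e₁.eval s - e₂.eval s).size + 1
  | .mul e₁ e₂ => e₁.cost s + e₂.cost s + (e₁.eval s * e₂.eval s).size + 1
  | .div e₁ e₂ => e₁.cost s + e₂.cost s + (e₁.eval s / e₂.eval s).size + 1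

/-- Programs: assignment to a register, assignment to an array cell, a coin toss, appending a
number to the output tape, sequencing, branching on `e ≠ 0`, and looping while `e ≠ 0`. -/
inductive Prog where
  | skip : Prog
  | assign (x : ℕ) (e : Expr) : Prog
  | store (a : ℕ) (i e : Expr) : Prog
  | flip (x : ℕ) : Prog
  | output (e : Expr) : Prog
  | seq (c₁ c₂ : Prog) : Prog
  | branch (e : Expr) (c₁ c₂ : Prog) : Prog
  | loop (e : Expr) (c : Prog) : Prog

/-- `Exec c s s' t`: program `c`, started in configuration `s`, halts in configuration `s'`
after a run of total logarithmic cost exactly `t`. A coin toss reads the next bit of the random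
tape; there is no halting run that tosses a coin after the random tape has been used up. -/
inductive Exec : Prog → State → State → ℕ → Prop where
  | skip (s : State) : Exec .skip s s 1
  | assign (x : ℕ) (e : Expr) (s : State) :
      Exec (.assign x e) s { s with reg := Function.update s.reg x (e.eval s) } (e.cost s + 1)
  | store (a : ℕ) (i e : Expr) (s : State) :
      Exec (.store a i e) s
        { s with mem := Function.update s.mem a
                          (Function.update (s.mem a) (i.eval s) (e.eval s)) }
        (i.cost s + e.cost s + 1)
  | flip (x : ℕ) (s : State) (b : Bool) (r : List Bool) (h : s.coins = b :: r) :
      Exec (.flip x) s { s with reg := Function.update s.reg x b.toNat, coins := r } 1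
  | output (e : Expr) (s : State) :
      Exec (.output e) s { s with out := s.out ++ [e.eval s] } (e.cost s + 1)
  | seq {c₁ c₂ : Prog} {s s' s'' : State} {t₁ t₂ : ℕ}
      (h₁ : Exec c₁ s s' t₁) (h₂ : Exec c₂ s' s'' t₂) :
      Exec (.seq c₁ c₂) s s'' (t₁ + t₂)
  | branch_then {e : Expr} {c₁ c₂ : Prog} {s s' : State} {t : ℕ}
      (h : e.eval s ≠ 0) (h₁ : Exec c₁ s s' t) :
      Exec (.branch e c₁ c₂) s s' (e.cost s + 1 + t)
  | branch_else {e : Expr} {c₁ c₂ : Prog} {s s' : State} {t : ℕ}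
      (h : e.eval s = 0) (h₂ : Exec c₂ s s' t) :
      Exec (.branch e c₁ c₂) s s' (e.cost s + 1 + t)
  | loop_stop {e : Expr} {c : Prog} {s : State} (h : e.eval s = 0) :
      Exec (.loop e c) s s (e.cost s + 1)
  | loop_step {e : Expr} {c : Prog} {s s' s'' : State} {t₁ t₂ : ℕ}
      (h : e.eval s ≠ 0) (h₁ : Exec c s s' t₁) (h₂ : Exec (.loop e c) s' s'' t₂) :
      Exec (.loop e c) s s'' (e.cost s + 1 + t₁ + t₂)

/-- Given the random tape, a run is determined by its program and its first configuration. -/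
theorem Exec.det {c : Prog} {s s₁ s₂ : State} {t₁ t₂ : ℕ}
    (h₁ : Exec c s s₁ t₁) (h₂ : Exec c s s₂ t₂) : s₁ = s₂ ∧ t₁ = t₂ := by
  induction h₁ generalizing s₂ t₂ with
  | skip | assign | store | output => cases h₂; exact ⟨rfl, rfl⟩
  | flip x s b r h =>
    cases h₂ with
    | flip _ _ b' r' h' =>
      rw [h] at h'
      obtain ⟨rfl, rfl⟩ := List.cons.inj h'
      exact ⟨rfl, rfl⟩
  | seq _ _ ih₁ ih₂ =>
    cases h₂ with
    | seq k₁ k₂ =>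
      obtain ⟨rfl, rfl⟩ := ih₁ k₁
      obtain ⟨rfl, rfl⟩ := ih₂ k₂
      exact ⟨rfl, rfl⟩
  | branch_then h _ ih =>
    cases h₂ with
    | branch_then _ k =>
      obtain ⟨rfl, rfl⟩ := ih k
      exact ⟨rfl, rfl⟩
    | branch_else k _ => exact absurd k h
  | branch_else h _ ih =>
    cases h₂ with
    | branch_then k _ => exact absurd h k
    | branch_else _ k =>
      obtain ⟨rfl, rfl⟩ := ih k
      exact ⟨rfl, rfl⟩
  | loop_stop h =>
    cases h₂ with
    | loop_stop _ => exact ⟨rfl, rfl⟩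
    | loop_step k _ _ => exact absurd h k
  | loop_step h _ _ ih₁ ih₂ =>
    cases h₂ with
    | loop_stop k => exact absurd k h
    | loop_step _ k₁ k₂ =>
      obtain ⟨rfl, rfl⟩ := ih₁ k₁
      obtain ⟨rfl, rfl⟩ := ih₂ k₂
      exact ⟨rfl, rfl⟩

/-- The first configuration on input word `w` with random tape `r`: array `0` holds the input,
register `0` its number of entries; all other registers and cells are `0`. -/
def initState (w : List ℕ) (r : List Bool) : State where
  reg := fun x => if x = 0 then w.length else 0
  mem := fun a i => if a = 0 then w.getD i 0 else 0
  coins := r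
  out := []

/-- On input `w` with random tape `r`, program `c` halts with output `o` after a run of
logarithmic cost at most `T`. -/
def OutputsInTime (c : Prog) (w : List ℕ) (r : List Bool) (o : List ℕ) (T : ℕ) : Prop :=
  ∃ (s : State) (t : ℕ), Exec c (initState w r) s t ∧ s.out = o ∧ t ≤ T

/-- The bit length of an input word. -/
def inputSize (w : List ℕ) : ℕ := (w.map fun a => a.size + 1).sum

end RAM

/-! ## Signaling with known valuations and the `K`-anonymity constraint -/

/-- An instance: `m` categories with prior probabilities `p j`, `n` bidders with values `v i j`
for category `j`, and the anonymity parameter `K`. -/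
structure SignalingInstance where
  m : ℕ
  n : ℕ
  K : ℕ
  n_pos : 0 < n
  K_pos : 0 < K
  K_le : K ≤ m
  p : Fin m → ℚ≥0
  p_sum : ∑ j, p j = 1
  v : Fin n → Fin m → ℚ≥0

namespace SignalingInstance

variable (I : SignalingInstance)

/-- A pure signaling scheme: a map from categories to signals (labelled by natural numbers). -/
abbrev Scheme : Type := Fin I.m → ℕ

variable {I}

/-- `φ(j, S) ∈ {0, 1}`, the probability that signal `S` is broadcast in category `j`. -/
def phi (f : I.Scheme) (j : Fin I.m) (S : ℕ) : ℚ≥0 := if f j = S then 1 else 0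

/-- The support of a signal. -/
def support (f : I.Scheme) (S : ℕ) : Finset (Fin I.m) := {j | phi f j S = 1}

/-- The signals that the scheme uses. -/
def signals (f : I.Scheme) : Finset ℕ := Finset.univ.image f

/-- The probability of broadcasting `S`. -/
def signalProb (f : I.Scheme) (S : ℕ) : ℚ≥0 := ∑ j, I.p j * phi f j S

/-- The conditional expectation of bidder `i`'s value given the signal `S`. -/
def condValue (f : I.Scheme) (i : Fin I.n) (S : ℕ) : ℚ≥0 :=
  (∑ j, I.v i j * I.p j * phi f j S) / signalProb f S

/-- The expected welfare `∑_S Pr[S] * max_i E[v_i | S]`. The supremum over the (non-empty) set of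
bidders is a maximum. -/
def welfare (f : I.Scheme) : ℚ≥0 :=
  ∑ S ∈ signals f, signalProb f S * Finset.univ.sup fun i => condValue f i S

/-- The `K`-anonymity constraint: the support of every signal in use has at least `K` elements. -/
def IsKAnonymous (f : I.Scheme) : Prop := ∀ S ∈ signals f, I.K ≤ (support f S).card

variable (I)

/-- The input word of an instance: `m`, `n`, `K`, then the numerators and the denominators of the
prior, then the numerators and the denominators of the valuations in row-major order. -/
def encode : List ℕ :=
  [I.m, I.n, I.K] ++
    (List.ofFn fun j : Fin I.m => (I.p j).num) ++
    (List.ofFn fun j : Fin I.m => (I.p j).den) ++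
    (List.ofFn fun k : Fin (I.n * I.m) => (I.v k.divNat k.modNat).num) ++
    (List.ofFn fun k : Fin (I.n * I.m) => (I.v k.divNat k.modNat).den)

/-- The bit length of an instance. -/
def size : ℕ := RAM.inputSize I.encode

end SignalingInstance

/-! A `K`-anonymous scheme uses at most `k = ⌊m/K⌋` signals. Giving each signal to a best bidder
turns its welfare into the value `∑ j, v (τ j) j * p j` of an assignment `τ` of the categories to at
most `k` bidders. Conversely, an assignment is itself a scheme, with bidders as signals, whose
welfare is at least its value (`le_welfare`). So it suffices to find an assignment in which every
bidder used owns at least `K` categories and whose value is at least `(1 - 1/e)/2` times that of any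
assignment to at most `k` bidders.

Choosing `k` bidders and giving each category to the best of them maximizes a monotone submodular
function under a cardinality constraint. Each greedy round closes at least a fraction `1/k` of the
gap to any competitor (`sum_le_add_mul_gain`), so `k` rounds reach the ratio `1 - (1 - 1/k)^k ≥ 1 -
1/e` (`GreedyInv.step`, `one_sub_inv_exp_le`).

The greedy assignment need not be anonymous. Call an owner large if it has at least `K` categories,
small otherwise. If the large owners carry at least half of the value, one of them receives all
categories of the small ones (`repaired_of_large`). Otherwise the small owners keep theirs and
receive those of the large ones, deficient owners first; this suffices because there are at most `k`
owners and `k * K ≤ m` (`FillInv.le_count`). Half of the value survives, whence `2e/(e-1)`.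

The algorithm never tosses a coin: the bound holds on every tape, and the expectation is a plain
average. For the running time, the values are scaled to integers by the product of all denominators,
and `Runs` tracks a word length `b` that bounds all stored numbers and all iteration counts and is
linear in the input size. -/

namespace RAM

/-! ### Logarithmic cost in terms of word length, and rules for total correctness. -/

open Polynomial

/-- A factor that bounds the logarithmic cost of an expression in the word length of the state. -/
def Expr.weight : Expr → ℕ
  | .lit k => k.size + 1
  | .reg _ => 1
  | .cell _ i => i.weight + 1
  | .add e₁ e₂ => 2 * (e₁.weight + e₂.weight) + 2
  | .sub e₁ e₂ => 2 * (e₁.weight + e₂.weight) + 2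
  | .mul e₁ e₂ => 2 * (e₁.weight + e₂.weight) + 2
  | .div e₁ e₂ => 2 * (e₁.weight + e₂.weight) + 2

/-- All registers and cells hold numbers of at most `b` bits. -/
def State.Bounded (b : ℕ) (s : State) : Prop :=
  (∀ x, s.reg x < 2 ^ b) ∧ ∀ a i, s.mem a i < 2 ^ b

theorem Expr.size_eval_le_cost (s : State) (e : Expr) : (e.eval s).size ≤ e.cost s := by
  cases e <;> simp only [Expr.eval, Expr.cost] <;> omega

theorem size_add_le (a b : ℕ) : (a + b).size ≤ a.size + b.size + 1 := by
  rw [Nat.size_le]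
  have ha := Nat.lt_size_self a
  have hb := Nat.lt_size_self b
  have h1 : 2 ^ a.size ≤ 2 ^ (a.size + b.size) := Nat.pow_le_pow_right (by norm_num) (by omega)
  have h2 : 2 ^ b.size ≤ 2 ^ (a.size + b.size) := Nat.pow_le_pow_right (by norm_num) (by omega)
  rw [pow_succ]
  omega

theorem size_mul_le (a b : ℕ) : (a * b).size ≤ a.size + b.size := by
  rw [Nat.size_le, pow_add]
  exact Nat.mul_lt_mul'' (Nat.lt_size_self a) (Nat.lt_size_self b)

/-- Only stored numbers are known to fit in `b` bits; intermediate values may be longer. The length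
of a value is at most the cost of computing it, so the length of a result is charged to the costs of
the operands; hence the doubling in `Expr.weight`. -/
theorem Expr.cost_le {b : ℕ} {s : State} (hs : s.Bounded b) (e : Expr) :
    e.cost s ≤ e.weight * (b + 1) := by
  induction e with
  | lit k => simp only [Expr.cost, Expr.weight]; exact Nat.le_mul_of_pos_right _ (by omega)
  | reg x =>
    have := Nat.size_le.2 (hs.1 x)
    simp only [Expr.cost, Expr.weight]; omega
  | cell a i ih =>
    have := Nat.size_le.2 (hs.2 a (i.eval s))
    simp only [Expr.cost, Expr.weight]; linarith
  | add e₁ e₂ ih₁ ih₂ =>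
    have := size_add_le (e₁.eval s) (e₂.eval s)
    have h1 := e₁.size_eval_le_cost s
    have h2 := e₂.size_eval_le_cost s
    simp only [Expr.cost, Expr.weight]; linarith
  | sub e₁ e₂ ih₁ ih₂ =>
    have := Nat.size_le_size (Nat.sub_le (e₁.eval s) (e₂.eval s))
    have h1 := e₁.size_eval_le_cost s
    simp only [Expr.cost, Expr.weight]; linarith
  | mul e₁ e₂ ih₁ ih₂ =>
    have := size_mul_le (e₁.eval s) (e₂.eval s)
    have h1 := e₁.size_eval_le_cost s
    have h2 := e₂.size_eval_le_cost s
    simp only [Expr.cost, Expr.weight]; linarith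
  | div e₁ e₂ ih₁ ih₂ =>
    have := Nat.size_le_size (Nat.div_le_self (e₁.eval s) (e₂.eval s))
    have h1 := e₁.size_eval_le_cost s
    simp only [Expr.cost, Expr.weight]; linarith

/-- A bound for the running time in the word length `b`, valid as long as every loop makes at most
`b` iterations. -/
noncomputable def Prog.time : Prog → ℕ[X]
  | .skip => 1
  | .assign _ e => C e.weight * (X + 1) + 1
  | .store _ i e => C (i.weight + e.weight) * (X + 1) + 1
  | .flip _ => 1
  | .output e => C e.weight * (X + 1) + 1
  | .seq c₁ c₂ => c₁.time + c₂.time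
  | .branch e c₁ c₂ => C e.weight * (X + 1) + 1 + c₁.time + c₂.time
  | .loop e c => (X + 1) * (C e.weight * (X + 1) + 1 + c.time)

/-- From `s`, program `c` halts within its time bound in a configuration with `b`-bit entries that
satisfies `Q`. -/
def Runs (b : ℕ) (c : Prog) (s : State) (Q : State → Prop) : Prop :=
  ∃ s' t, Exec c s s' t ∧ t ≤ c.time.eval b ∧ s'.Bounded b ∧ Q s'

variable {b : ℕ} {s : State} {Q R : State → Prop}

theorem Runs.mono {c : Prog} (h : Runs b c s R) (hQ : ∀ s, s.Bounded b → R s → Q s) :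
    Runs b c s Q := by
  obtain ⟨s', t, h1, h2, h3, h4⟩ := h
  exact ⟨s', t, h1, h2, h3, hQ _ h3 h4⟩

theorem Runs.skip (hs : s.Bounded b) (h : Q s) : Runs b .skip s Q :=
  ⟨s, 1, .skip s, by simp [Prog.time], hs, h⟩

theorem State.Bounded.update_reg (hs : s.Bounded b) (x : ℕ) {v : ℕ} (hv : v < 2 ^ b) :
    State.Bounded b { s with reg := Function.update s.reg x v } := by
  refine ⟨fun y => ?_, hs.2⟩
  by_cases h : y = x
  · simp [h, hv]
  · simpa [h] using hs.1 y

theorem Runs.assign {x : ℕ} {e : Expr} (hs : s.Bounded b) (he : e.eval s < 2 ^ b)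
    (h : Q { s with reg := Function.update s.reg x (e.eval s) }) : Runs b (.assign x e) s Q :=
  ⟨_, _, .assign x e s, by simpa [Prog.time] using e.cost_le hs, hs.update_reg x he, h⟩

theorem Runs.store {a : ℕ} {i e : Expr} (hs : s.Bounded b) (he : e.eval s < 2 ^ b)
    (h : Q { s with mem := Function.update s.mem a
                          (Function.update (s.mem a) (i.eval s) (e.eval s)) }) :
    Runs b (.store a i e) s Q := by
  refine ⟨_, _, .store a i e s, ?_, ⟨hs.1, fun a' i' => ?_⟩, h⟩
  · have h1 := i.cost_le hs
    have h2 := e.cost_le hs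
    simp only [Prog.time, eval_add, eval_mul, eval_C, eval_X, eval_one]
    linarith
  · by_cases h : a' = a
    · subst h
      by_cases h' : i' = i.eval s
      · simp [h', he]
      · simpa [h'] using hs.2 a' i'
    · simpa [h] using hs.2 a' i'

theorem Runs.output {e : Expr} (hs : s.Bounded b) (h : Q { s with out := s.out ++ [e.eval s] }) :
    Runs b (.output e) s Q :=
  ⟨_, _, .output e s, by simpa [Prog.time] using e.cost_le hs, hs, h⟩

theorem Runs.seq {c₁ c₂ : Prog} (h : Runs b c₁ s R)
    (h' : ∀ s, s.Bounded b → R s → Runs b c₂ s Q) : Runs b (.seq c₁ c₂) s Q := by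
  obtain ⟨s₁, t₁, h1, h2, h3, h4⟩ := h
  obtain ⟨s₂, t₂, k1, k2, k3, k4⟩ := h' s₁ h3 h4
  refine ⟨s₂, _, .seq h1 k1, ?_, k3, k4⟩
  simp only [Prog.time, eval_add]
  omega

theorem Runs.branch {e : Expr} {c₁ c₂ : Prog} (hs : s.Bounded b)
    (h₁ : e.eval s ≠ 0 → Runs b c₁ s Q) (h₂ : e.eval s = 0 → Runs b c₂ s Q) :
    Runs b (.branch e c₁ c₂) s Q := by
  have hc := e.cost_le hs
  by_cases h : e.eval s = 0
  · obtain ⟨s', t, k1, k2, k3, k4⟩ := h₂ h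
    refine ⟨s', _, .branch_else h k1, ?_, k3, k4⟩
    simp only [Prog.time, eval_add, eval_mul, eval_C, eval_X, eval_one]
    omega
  · obtain ⟨s', t, k1, k2, k3, k4⟩ := h₁ h
    refine ⟨s', _, .branch_then h k1, ?_, k3, k4⟩
    simp only [Prog.time, eval_add, eval_mul, eval_C, eval_X, eval_one]
    omega

/-- The loop that runs `c` for all values of register `x` below that of `N`. -/
def Prog.forLoop (x : ℕ) (N : Expr) (c : Prog) : Prog :=
  .seq (.assign x (.lit 0))
    (.loop (.sub N (.reg x)) (.seq c (.assign x (.add (.reg x) (.lit 1)))))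

/-- The invariant refers to the state after the increment, so the body only has to return register
`x` unchanged. The hypothesis `n ≤ b` serves twice: it bounds the number of iterations, and through
`b < 2 ^ b` it keeps the counter within the word length. -/
theorem Runs.forLoop {x : ℕ} {N : Expr} {c : Prog} (Inv : ℕ → State → Prop) (n : ℕ)
    (hs : s.Bounded b) (hn : n ≤ b)
    (h0 : Inv 0 { s with reg := Function.update s.reg x 0 })
    (hN : ∀ t s, Inv t s → N.eval s = n)
    (hstep : ∀ t < n, ∀ s, s.Bounded b → s.reg x = t → Inv t s → Runs b c s fun s' =>
      s'.reg x = t ∧ Inv (t + 1) { s' with reg := Function.update s'.reg x (t + 1) })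
    (hpost : ∀ s, s.Bounded b → Inv n s → Q s) :
    Runs b (.forLoop x N c) s Q := by
  have hb : b < 2 ^ b := Nat.lt_two_pow_self
  refine Runs.seq (R := fun s => s.reg x = 0 ∧ Inv 0 s) (Runs.assign hs (Nat.two_pow_pos b) ?_) ?_
  · exact ⟨by simp [Expr.eval], h0⟩
  rintro s hs ⟨hx, hI⟩
  set e : Expr := .sub N (.reg x) with he
  set d : Prog := .seq c (.assign x (.add (.reg x) (.lit 1))) with hd
  -- Induction on the number `k` of iterations left; the extra one in `k + 1` pays for the last test
  -- of the guard.
  have key : ∀ k t s, t + k = n → State.Bounded b s → s.reg x = t → Inv t s →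
      ∃ s' T, Exec (.loop e d) s s' T ∧
        T ≤ (k + 1) * (e.weight * (b + 1) + 1 + d.time.eval b) ∧ s'.Bounded b ∧ Inv n s' := by
    intro k
    induction k with
    | zero =>
      intro t s ht hs hx hI
      obtain rfl : t = n := by omega
      refine ⟨s, _, Exec.loop_stop ?_, ?_, hs, hI⟩
      · simp [he, Expr.eval, hN _ _ hI, hx]
      · have := e.cost_le hs
        omega
    | succ k ih =>
      intro t s ht hs hx hI
      obtain ⟨s₁, T₁, h1, h2, h3, h4⟩ : Runs b d s fun s' => s'.reg x = t + 1 ∧ Inv (t + 1) s' := by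
        refine Runs.seq (hstep t (by omega) s hs hx hI) ?_
        rintro s' hs' ⟨hx', hI'⟩
        have hv : (Expr.add (.reg x) (.lit 1)).eval s' = t + 1 := by simp [Expr.eval, hx']
        refine Runs.assign hs' (by rw [hv]; omega) ?_
        rw [hv]
        exact ⟨by simp, hI'⟩
      obtain ⟨s₂, T₂, k1, k2, k3, k4⟩ := ih (t + 1) s₁ (by omega) h3 h4.1 h4.2
      refine ⟨s₂, _, .loop_step ?_ h1 k1, ?_, k3, k4⟩
      · simp only [he, Expr.eval, hN _ _ hI, hx]
        omega
      · have := e.cost_le hs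
        linarith
  obtain ⟨s', T, h1, h2, h3, h4⟩ := key n 0 s (by omega) hs hx hI
  refine ⟨s', T, h1, h2.trans ?_, h3, hpost _ h3 h4⟩
  simp only [Prog.time, eval_add, eval_mul, eval_C, eval_X, eval_one]
  exact Nat.mul_le_mul_right _ (by omega)

end RAM

/-! ### The greedy guarantee. -/

namespace Signaling

open Finset

/-- The state of the greedy algorithm after `t` rounds, with budget `k`: `own j` is the bidder to
whom category `j < m` is assigned, at value `cur j`. -/
structure GreedyInv (W : ℕ → ℕ → ℕ) (m n k t : ℕ) (cur own : ℕ → ℕ) : Prop where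
  cur_zero : t = 0 → ∀ j < m, cur j = 0
  own_lt : ∀ j < m, own j < n
  cur_eq : 0 < t → ∀ j < m, cur j = W (own j) j
  card_le : 0 < t → ((range m).image own).card ≤ t
  value : ∀ τ : ℕ → ℕ, (∀ j < m, τ j < n) → ((range m).image τ).card ≤ k →
    (1 - (1 - 1 / (k : ℝ)) ^ t) * (∑ j ∈ range m, W (τ j) j : ℕ) ≤ (∑ j ∈ range m, cur j : ℕ)

theorem greedyInv_zero (W : ℕ → ℕ → ℕ) {m n : ℕ} (k : ℕ) (hn : 0 < n) :
    GreedyInv W m n k 0 (fun _ => 0) (fun _ => 0) where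
  cur_zero _ _ _ := rfl
  own_lt _ _ := hn
  cur_eq h := absurd h (lt_irrefl _)
  card_le h := absurd h (lt_irrefl _)
  value τ _ _ := by simp

theorem GreedyInv.cur_le {W : ℕ → ℕ → ℕ} {m n k t : ℕ} {cur own : ℕ → ℕ}
    (h : GreedyInv W m n k t cur own) {M : ℕ} (hM : ∀ i < n, ∀ j < m, W i j ≤ M) :
    ∀ j < m, cur j ≤ M := by
  intro j hj
  rcases Nat.eq_zero_or_pos t with ht | ht
  · rw [h.cur_zero ht j hj]; exact Nat.zero_le _
  · rw [h.cur_eq ht j hj]; exact hM _ (h.own_lt j hj) j hj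

/-- The marginal gains of at most `k` bidders add up to at least the missing value. -/
theorem sum_le_add_mul_gain {W : ℕ → ℕ → ℕ} {m k : ℕ} {cur τ : ℕ → ℕ} {i : ℕ}
    (hi : ∀ j < m, ∑ j' ∈ range m, max (cur j') (W (τ j) j') ≤
      ∑ j' ∈ range m, max (cur j') (W i j'))
    (hk : ((range m).image τ).card ≤ k) :
    (∑ j ∈ range m, W (τ j) j : ℝ) ≤ ∑ j ∈ range m, (cur j : ℝ) +
      k * (∑ j ∈ range m, ((max (cur j) (W i j) : ℕ) : ℝ) - ∑ j ∈ range m, (cur j : ℝ)) := by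
  set G : ℝ := ∑ j ∈ range m, ((max (cur j) (W i j) : ℕ) : ℝ) - ∑ j ∈ range m, (cur j : ℝ) with hG
  have hG0 : 0 ≤ G := by
    rw [hG, sub_nonneg]
    exact sum_le_sum fun j _ => by exact_mod_cast le_max_left _ _
  -- Each of the at most `k` bidders used by `τ` gains at most `G`, by the choice of `i`.
  have h1 : ∑ a ∈ (range m).image τ, ∑ j ∈ range m, (((max (cur j) (W a j) : ℕ) : ℝ) - cur j) ≤
      k * G := by
    refine (sum_le_card_nsmul _ _ G fun a ha => ?_).trans ?_
    · obtain ⟨j, hj, rfl⟩ := mem_image.1 ha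
      rw [sum_sub_distrib, hG]
      have := hi j (mem_range.1 hj)
      have : (∑ j' ∈ range m, ((max (cur j') (W (τ j) j') : ℕ) : ℝ)) ≤
        ∑ j' ∈ range m, ((max (cur j') (W i j') : ℕ) : ℝ) := by exact_mod_cast this
      linarith
    · rw [nsmul_eq_mul]
      exact mul_le_mul_of_nonneg_right (by exact_mod_cast hk) hG0
  rw [sum_comm] at h1
  -- In category `j` the bidder `τ j` alone accounts for the left side; the other terms are
  -- nonnegative.
  have h2 : ∑ j ∈ range m, ((W (τ j) j : ℝ) - cur j) ≤
      ∑ j ∈ range m, ∑ a ∈ (range m).image τ, (((max (cur j) (W a j) : ℕ) : ℝ) - cur j) := by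
    refine sum_le_sum fun j hj => ?_
    refine le_trans ?_ (single_le_sum (f := fun a => (((max (cur j) (W a j) : ℕ) : ℝ) - cur j))
      (fun a _ => ?_) (mem_image_of_mem τ hj))
    · simp
    · simp
  rw [sum_sub_distrib] at h2
  linarith

/-- The best bidder closes at least a fraction `1 / k` of the gap to `τ`, so the missing ratio
shrinks by `1 - 1 / k`. Ties go to the new bidder: in the first round `cur` is zero, so every
category passes to `i`, and the arbitrary initial owner never counts against the budget. -/
theorem GreedyInv.step {W : ℕ → ℕ → ℕ} {m n k t : ℕ} {cur own cur' own' : ℕ → ℕ} {i : ℕ}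
    (h : GreedyInv W m n k t cur own) (hk : 0 < k) (hi : i < n)
    (hmax : ∀ a < n, ∑ j ∈ range m, max (cur j) (W a j) ≤ ∑ j ∈ range m, max (cur j) (W i j))
    (hle : ∀ j < m, cur j ≤ W i j → cur' j = W i j ∧ own' j = i)
    (hlt : ∀ j < m, W i j < cur j → cur' j = cur j ∧ own' j = own j) :
    GreedyInv W m n k (t + 1) cur' own' where
  cur_zero ht := by omega
  own_lt j hj := by
    rcases le_or_gt (cur j) (W i j) with hc | hc
    · rw [(hle j hj hc).2]; exact hi
    · rw [(hlt j hj hc).2]; exact h.own_lt j hj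
  cur_eq _ j hj := by
    rcases le_or_gt (cur j) (W i j) with hc | hc
    · rw [(hle j hj hc).2, (hle j hj hc).1]
    · rw [(hlt j hj hc).2, (hlt j hj hc).1]
      refine h.cur_eq (Nat.pos_of_ne_zero fun ht => ?_) j hj
      rw [h.cur_zero ht j hj] at hc
      omega
  card_le _ := by
    rcases Nat.eq_zero_or_pos t with ht | ht
    · refine (card_le_card (t := {i}) fun a ha => ?_).trans (by simp)
      obtain ⟨j, hj, rfl⟩ := mem_image.1 ha
      rw [mem_range] at hj
      rw [mem_singleton, (hle j hj (by rw [h.cur_zero ht j hj]; omega)).2]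
    · refine (card_le_card (t := insert i ((range m).image own)) fun a ha => ?_).trans
        ((card_insert_le _ _).trans (Nat.succ_le_succ (h.card_le ht)))
      obtain ⟨j, hj, rfl⟩ := mem_image.1 ha
      rcases le_or_gt (cur j) (W i j) with hc | hc
      · rw [(hle j (mem_range.1 hj) hc).2]; exact mem_insert_self _ _
      · rw [(hlt j (mem_range.1 hj) hc).2]; exact mem_insert_of_mem (mem_image_of_mem _ hj)
  value τ hτ hc := by
    have h1 := h.value τ hτ hc
    have h2 := sum_le_add_mul_gain (i := i) (fun j hj => hmax _ (hτ j hj)) hc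
    have h3 : ∑ j ∈ range m, cur' j = ∑ j ∈ range m, max (cur j) (W i j) := by
      refine sum_congr rfl fun j hj => ?_
      rw [mem_range] at hj
      rcases le_or_gt (cur j) (W i j) with hc | hc
      · rw [(hle j hj hc).1, max_eq_right hc]
      · rw [(hlt j hj hc).1, max_eq_left hc.le]
    rw [h3]
    have hk' : (0 : ℝ) < k := by exact_mod_cast hk
    have hk1 : (1 : ℝ) ≤ k := by exact_mod_cast hk
    push_cast at h1 h2 ⊢
    set P := ∑ j ∈ range m, (W (τ j) j : ℝ)
    set C := ∑ j ∈ range m, (cur j : ℝ)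
    set C' := ∑ j ∈ range m, max (cur j : ℝ) (W i j : ℝ)
    set x : ℝ := 1 / k with hx
    have hxk : x * k = 1 := by rw [hx]; field_simp
    have hx1 : x ≤ 1 := by rw [hx, div_le_one hk']; exact hk1
    have hx0 : 0 ≤ x := by positivity
    have h4 : x * P ≤ x * C + (C' - C) := by
      have := mul_le_mul_of_nonneg_left h2 hx0
      calc x * P ≤ _ := this
        _ = x * C + (x * k) * (C' - C) := by ring
        _ = _ := by rw [hxk, one_mul]
    have h5 := mul_le_mul_of_nonneg_left h1 (sub_nonneg.2 hx1)
    rw [pow_succ]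
    linarith

theorem one_sub_inv_exp_le {k : ℕ} (hk : 0 < k) :
    1 - 1 / Real.exp 1 ≤ 1 - (1 - 1 / (k : ℝ)) ^ k := by
  have hk' : (0 : ℝ) < k := by exact_mod_cast hk
  have h1 : (1 : ℝ) ≤ k := by exact_mod_cast hk
  have h2 : 0 ≤ 1 - 1 / (k : ℝ) := by rw [sub_nonneg, div_le_one hk']; exact h1
  have h3 : 1 - 1 / (k : ℝ) ≤ Real.exp (-(1 / k)) := by
    have := Real.add_one_le_exp (-(1 / (k : ℝ))); linarith
  have h4 := pow_le_pow_left₀ h2 h3 k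
  rw [← Real.exp_nat_mul] at h4
  have h5 : (k : ℝ) * -(1 / k) = -1 := by field_simp
  rw [h5, Real.exp_neg, ← one_div] at h4
  linarith

/-! ### Repairing anonymity at the price of half the value. -/

/-- The number of categories below `m` with owner `i`. -/
def count (own : ℕ → ℕ) (m i : ℕ) : ℕ := ((range m).filter fun j => own j = i).card

theorem count_le (own : ℕ → ℕ) (m i : ℕ) : count own m i ≤ m :=
  (card_filter_le _ _).trans (by simp)

theorem count_succ (own : ℕ → ℕ) (m i : ℕ) :
    count own (m + 1) i = count own m i + if own m = i then 1 else 0 := by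
  rw [count, range_add_one, filter_insert]
  split_ifs with h
  · rw [card_insert_of_notMem (by simp)]; rfl
  · rfl

theorem count_pos {own : ℕ → ℕ} {m j : ℕ} (hj : j < m) : 0 < count own m (own j) :=
  card_pos.2 ⟨j, by simp [hj]⟩

theorem count_update {own : ℕ → ℕ} {m j : ℕ} (hj : j < m) {a : ℕ} (h : own j ≠ a) :
    count (Function.update own j a) m a = count own m a + 1 := by
  have : ((range m).filter fun j' => Function.update own j a j' = a) =
      insert j ((range m).filter fun j' => own j' = a) := by
    ext j'
    by_cases hjj : j' = j
    · subst hjj; simp [hj]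
    · simp [hjj]
  rw [count, this, card_insert_of_notMem (by simp [h])]
  rfl

theorem count_update_of_ne {own : ℕ → ℕ} {m j : ℕ} {a i : ℕ} (h : own j ≠ i) (ha : a ≠ i) :
    count (Function.update own j a) m i = count own m i := by
  refine congrArg card (filter_congr fun j' _ => ?_)
  by_cases hjj : j' = j
  · subst hjj; simp [h, ha]
  · simp [hjj]

/-- Moving the categories of large owners to small ones, after `t` steps: `f` is the current
assignment, `c` the array of counters. -/
structure FillInv (m n K : ℕ) (own : ℕ → ℕ) (t : ℕ) (f c : ℕ → ℕ) : Prop where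
  rest : ∀ j < m, t ≤ j → f j = own j
  keep : ∀ j < m, count own m (own j) < K → f j = own j
  done : ∀ j < m, j < t → f j < n ∧ 0 < count own m (f j) ∧ count own m (f j) < K
  large : ∀ i, K ≤ count own m i → K ≤ c i
  small : ∀ i, count own m i < K → c i = count f m i
  deficient : (∃ i, 0 < count own m i ∧ count own m i < K ∧ c i < K) →
    ∀ i, count own m i < K → c i ≤ K

theorem fillInv_zero (m n K : ℕ) (own : ℕ → ℕ) :
    FillInv m n K own 0 own (count own m) where
  rest _ _ _ := rfl
  keep _ _ _ := rfl
  done _ _ h := absurd h (Nat.not_lt_zero _)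
  large _ h := h
  small _ _ := rfl
  deficient _ _ h := h.le

theorem FillInv.step_keep {m n K : ℕ} {own : ℕ → ℕ} {t : ℕ} {f c : ℕ → ℕ}
    (h : FillInv m n K own t f c) (ht : t < m) (hn : own t < n) (hK : count own m (own t) < K) :
    FillInv m n K own (t + 1) f c where
  rest j hj hjt := h.rest j hj (by omega)
  keep := h.keep
  done j hj hjt := by
    rcases Nat.lt_succ_iff_lt_or_eq.1 hjt with hlt | rfl
    · exact h.done j hj hlt
    · rw [h.keep j hj hK]
      exact ⟨hn, count_pos ht, hK⟩
  large := h.large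
  small := h.small
  deficient := h.deficient

/-- If an owner in use is deficient after the move, one was before, so `hdef` makes `a` deficient
and the increment does not push `c a` beyond `K`. Counters of large owners are never decreased, so
these owners never look deficient. -/
theorem FillInv.step_move {m n K : ℕ} {own : ℕ → ℕ} {t : ℕ} {f c : ℕ → ℕ}
    (h : FillInv m n K own t f c) (ht : t < m) (hK : K ≤ count own m (own t)) {a : ℕ} (ha : a < n)
    (ha0 : 0 < count own m a) (haK : count own m a < K)
    (hdef : (∃ i < n, 0 < count own m i ∧ c i < K) → c a < K) (hown : ∀ j < m, own j < n) :
    FillInv m n K own (t + 1) (Function.update f t a) (Function.update c a (c a + 1)) where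
  rest j hj hjt := by
    rw [Function.update_of_ne (by omega)]
    exact h.rest j hj (by omega)
  keep j hj hc := by
    rw [Function.update_of_ne (by rintro rfl; omega)]
    exact h.keep j hj hc
  done j hj hjt := by
    rcases Nat.lt_succ_iff_lt_or_eq.1 hjt with hlt | rfl
    · rw [Function.update_of_ne (by omega)]
      exact h.done j hj hlt
    · rw [Function.update_self]
      exact ⟨ha, ha0, haK⟩
  large i hi := by
    rw [Function.update_of_ne (by rintro rfl; omega)]
    exact h.large i hi
  small i hi := by
    have hft : f t ≠ i := by rw [h.rest t ht le_rfl]; rintro rfl; omega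
    by_cases hia : i = a
    · subst hia
      rw [Function.update_self, count_update ht hft, h.small i hi]
    · rw [Function.update_of_ne hia, count_update_of_ne hft (Ne.symm hia), h.small i hi]
  deficient := by
    rintro ⟨i, hi0, hiK, hic⟩ i' hi'
    have hcK : c i < K := by
      by_cases hia : i = a
      · subst hia; rw [Function.update_self] at hic; omega
      · rwa [Function.update_of_ne hia] at hic
    have hin : i < n := by
      obtain ⟨j, hj⟩ := card_pos.1 hi0
      rw [mem_filter, mem_range] at hj
      rw [← hj.2]; exact hown j hj.1
    by_cases hia : i' = a
    · subst hia
      rw [Function.update_self]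
      exact hdef ⟨i, hin, hi0, hcK⟩
    · rw [Function.update_of_ne hia]
      exact h.deficient ⟨i, hi0, hiK, hcK⟩ i' hi'

/-- After all steps, every signal in use is sent by at least `K` categories. -/
theorem FillInv.le_count {m n K : ℕ} {own : ℕ → ℕ} {f c : ℕ → ℕ}
    (h : FillInv m n K own m f c) (hk : ((range m).image own).card * K ≤ m) :
    ∀ j < m, K ≤ count f m (f j) := by
  intro j hj
  by_contra! hlt
  obtain ⟨-, h0, hK⟩ := h.done j hj hj
  have hdef := h.deficient ⟨f j, h0, hK, by rw [h.small _ hK]; exact hlt⟩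
  -- All categories now belong to `S`, the small owners originally in use. If one of these is short
  -- of `K`, none exceeds `K`, so the `m` categories would number fewer than `S.card * K ≤ m`.
  set S := ((range m).image own).filter fun i => count own m i < K with hS
  have hmem : ∀ i ∈ range m, f i ∈ S := by
    intro i hi
    rw [mem_range] at hi
    obtain ⟨-, h0', hK'⟩ := h.done i hi hi
    obtain ⟨j', hj'⟩ := card_pos.1 h0'
    rw [mem_filter] at hj'
    rw [hS, mem_filter, mem_image]
    exact ⟨⟨j', hj'.1, hj'.2⟩, hK'⟩
  have h1 : m = ∑ i ∈ S, count f m i := by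
    simpa [count] using card_eq_sum_card_fiberwise hmem
  have h2 : ∑ i ∈ S, count f m i < ∑ _i ∈ S, K := by
    refine sum_lt_sum (fun i hi => ?_) ⟨f j, hmem j (mem_range.2 hj), hlt⟩
    rw [hS, mem_filter] at hi
    rw [← h.small i hi.2]
    exact hdef i hi.2
  have h3 : ∑ _i ∈ S, K ≤ m := by
    rw [sum_const, smul_eq_mul]
    exact (Nat.mul_le_mul_right K (card_filter_le _ _)).trans hk
  omega

/-- An assignment of the categories to bidders that is a `K`-anonymous scheme and retains half of
the value of `own`. -/
structure Repaired (W : ℕ → ℕ → ℕ) (m n K : ℕ) (own f : ℕ → ℕ) : Prop where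
  lt : ∀ j < m, f j < n
  le_count : ∀ j < m, K ≤ count f m (f j)
  value : ∑ j ∈ range m, W (own j) j ≤ 2 * ∑ j ∈ range m, W (f j) j

/-- The part on which `f` keeps the owners is worth at least half of the total, and the values
elsewhere are nonnegative. -/
theorem sum_le_two_mul_sum {W : ℕ → ℕ → ℕ} {m : ℕ} {own f : ℕ → ℕ} {p : ℕ → Prop}
    [DecidablePred p] (hf : ∀ j < m, p j → f j = own j)
    (hp : ∑ j ∈ (range m).filter (fun j => ¬ p j), W (own j) j ≤
      ∑ j ∈ (range m).filter p, W (own j) j) :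
    ∑ j ∈ range m, W (own j) j ≤ 2 * ∑ j ∈ range m, W (f j) j := by
  have h2 : ∑ j ∈ (range m).filter p, W (own j) j ≤ ∑ j ∈ range m, W (f j) j := by
    refine le_trans (le_of_eq (sum_congr rfl fun j hj => ?_))
      (sum_le_sum_of_subset (filter_subset p (range m)))
    rw [mem_filter, mem_range] at hj
    rw [hf j hj.1 hj.2]
  rw [← sum_filter_add_sum_filter_not (range m) p, two_mul]
  exact add_le_add h2 (hp.trans h2)

theorem FillInv.repaired {W : ℕ → ℕ → ℕ} {m n K : ℕ} {own : ℕ → ℕ} {f c : ℕ → ℕ}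
    (h : FillInv m n K own m f c) (hk : ((range m).image own).card * K ≤ m)
    (hv : ∑ j ∈ (range m).filter (fun j => ¬ count own m (own j) < K), W (own j) j ≤
      ∑ j ∈ (range m).filter (fun j => count own m (own j) < K), W (own j) j) :
    Repaired W m n K own f where
  lt j hj := (h.done j hj hj).1
  le_count := h.le_count hk
  value := sum_le_two_mul_sum h.keep hv

/-- Large owners lose nothing and so stay large, and every category ends up with one of them. -/
theorem repaired_of_large {W : ℕ → ℕ → ℕ} {m n K : ℕ} {own : ℕ → ℕ} {f : ℕ → ℕ} {a : ℕ}
    (hown : ∀ j < m, own j < n) (ha : a < n) (haK : K ≤ count own m a)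
    (hl : ∀ j < m, K ≤ count own m (own j) → f j = own j)
    (hs : ∀ j < m, count own m (own j) < K → f j = a)
    (hv : ∑ j ∈ (range m).filter (fun j => ¬ K ≤ count own m (own j)), W (own j) j ≤
      ∑ j ∈ (range m).filter (fun j => K ≤ count own m (own j)), W (own j) j) :
    Repaired W m n K own f where
  lt j hj := by
    rcases le_or_gt K (count own m (own j)) with h | h
    · rw [hl j hj h]; exact hown j hj
    · rw [hs j hj h]; exact ha
  le_count j hj := by
    have key : ∀ i, K ≤ count own m i → K ≤ count f m i := by
      intro i hi
      refine hi.trans (card_le_card fun j' hj' => ?_)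
      rw [mem_filter, mem_range] at hj' ⊢
      refine ⟨hj'.1, ?_⟩
      rw [hl j' hj'.1 (by rw [hj'.2]; exact hi), hj'.2]
    rcases le_or_gt K (count own m (own j)) with h | h
    · rw [hl j hj h]; exact key _ h
    · rw [hs j hj h]; exact key _ haK
  value := sum_le_two_mul_sum hl hv

end Signaling

/-! ### The greedy program. -/

namespace Signaling

open RAM Finset

/-- The integral value of category `j` for bidder `i`, read off an input word `inp`; `D` is a common
denominator. -/
def intValue (inp : ℕ → ℕ) (m n D i j : ℕ) : ℕ :=
  inp (3 + 2 * m + (i * m + j)) * inp (3 + j) *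
    (D / (inp (3 + 2 * m + n * m + (i * m + j)) * inp (3 + m + j)))

/-- The expression for `intValue` with `i` and `j` in registers `x` and `y`. -/
def valueExpr (x y : ℕ) : Expr :=
  .mul (.mul (.cell 0 (.add (.add (.lit 3) (.mul (.lit 2) (.reg 1)))
      (.add (.mul (.reg x) (.reg 1)) (.reg y)))) (.cell 0 (.add (.lit 3) (.reg y))))
    (.div (.reg 4) (.mul
      (.cell 0 (.add (.add (.add (.lit 3) (.mul (.lit 2) (.reg 1))) (.mul (.reg 2) (.reg 1)))
        (.add (.mul (.reg x) (.reg 1)) (.reg y))))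
      (.cell 0 (.add (.add (.lit 3) (.reg 1)) (.reg y)))))

/-- The data that the main part of the program reads but does not change. -/
structure Ctx (inp : ℕ → ℕ) (m n K D : ℕ) (s : State) : Prop where
  reg_m : s.reg 1 = m
  reg_n : s.reg 2 = n
  reg_K : s.reg 3 = K
  reg_D : s.reg 4 = D
  mem_inp : s.mem 0 = inp
  out_nil : s.out = []

section

variable {inp : ℕ → ℕ} {m n K D : ℕ} {s : State}

theorem Ctx.reg (h : Ctx inp m n K D s) (x v : ℕ) (hx : 4 < x := by norm_num) :
    Ctx inp m n K D { s with reg := Function.update s.reg x v } := by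
  constructor <;> simp only
  · rw [Function.update_of_ne (by omega), h.reg_m]
  · rw [Function.update_of_ne (by omega), h.reg_n]
  · rw [Function.update_of_ne (by omega), h.reg_K]
  · rw [Function.update_of_ne (by omega), h.reg_D]
  · exact h.mem_inp
  · exact h.out_nil

theorem Ctx.mem (h : Ctx inp m n K D s) (a : ℕ) (f : ℕ → ℕ) (ha : a ≠ 0 := by norm_num) :
    Ctx inp m n K D { s with mem := Function.update s.mem a f } where
  reg_m := h.reg_m
  reg_n := h.reg_n
  reg_K := h.reg_K
  reg_D := h.reg_D
  mem_inp := by simp only; rw [Function.update_of_ne ha.symm, h.mem_inp]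
  out_nil := h.out_nil

theorem Ctx.eval_valueExpr (h : Ctx inp m n K D s) (x y : ℕ) :
    (valueExpr x y).eval s = intValue inp m n D (s.reg x) (s.reg y) := by
  simp [valueExpr, intValue, Expr.eval, h.reg_m, h.reg_n, h.reg_D, h.mem_inp]

end

/-- Word length `b` suffices for running the program on the instance with values
`intValue inp m n D`. -/
structure WordLength (b : ℕ) (inp : ℕ → ℕ) (m n K D : ℕ) : Prop where
  K_pos : 0 < K
  K_le : K ≤ m
  n_pos : 0 < n
  m_le : m ≤ b
  n_le : n ≤ b
  sum_lt : ∃ M, (∀ i < n, ∀ j < m, intValue inp m n D i j ≤ M) ∧ m * M < 2 ^ b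

theorem sum_le_mul {m t M : ℕ} {g : ℕ → ℕ} (ht : t ≤ m) (hg : ∀ j < m, g j ≤ M) :
    ∑ j ∈ range t, g j ≤ m * M := by
  refine (sum_le_card_nsmul _ _ M fun j hj => hg j (by rw [mem_range] at hj; omega)).trans ?_
  rw [card_range, smul_eq_mul]
  exact Nat.mul_le_mul_right M ht

/-- Register `9` becomes the value after adding the bidder in register `8`. -/
def gainProg : Prog :=
  .seq (.assign 9 (.lit 0)) (.forLoop 10 (.reg 1)
    (.assign 9 (.add (.reg 9) (.add (.cell 2 (.reg 10))
      (.sub (valueExpr 8 10) (.cell 2 (.reg 10)))))))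

theorem gainProg_runs {b : ℕ} {inp : ℕ → ℕ} {m n K D : ℕ} (hb : WordLength b inp m n K D)
    {s : State} (hs : s.Bounded b) (hc : Ctx inp m n K D s) {cur : ℕ → ℕ} (hcur : s.mem 2 = cur)
    {M : ℕ} (hM : ∀ j < m, max (cur j) (intValue inp m n D (s.reg 8) j) ≤ M) (hMb : m * M < 2 ^ b) :
    Runs b gainProg s fun s' => Ctx inp m n K D s' ∧ s'.mem = s.mem ∧
      (∀ y < 9, s'.reg y = s.reg y) ∧
      s'.reg 9 = ∑ j ∈ range m, max (cur j) (intValue inp m n D (s.reg 8) j) := by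
  refine Runs.seq (R := fun s' => Ctx inp m n K D s' ∧ s'.mem = s.mem ∧
      (∀ y < 9, s'.reg y = s.reg y) ∧ s'.reg 9 = 0)
    (Runs.assign hs (Nat.two_pow_pos b) ⟨hc.reg _ _, rfl, fun y hy => ?_, ?_⟩) ?_
  · exact Function.update_of_ne (by omega) _ _
  · simp [Expr.eval]
  rintro s₁ hs₁ ⟨hc₁, hm₁, hr₁, h9⟩
  refine Runs.forLoop (fun t s' => Ctx inp m n K D s' ∧ s'.mem = s.mem ∧
      (∀ y < 9, s'.reg y = s.reg y) ∧
      s'.reg 9 = ∑ j ∈ range t, max (cur j) (intValue inp m n D (s.reg 8) j)) m hs₁ hb.m_le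
    ⟨hc₁.reg _ _, hm₁, fun y hy => ?_, ?_⟩ (fun t s h => h.1.reg_m) ?_ fun s' _ h => h
  · rw [← hr₁ y hy]; exact Function.update_of_ne (by omega) _ _
  · simp [h9]
  rintro t ht s₂ hs₂ hx ⟨hc₂, hm₂, hr₂, h9₂⟩
  -- With truncated subtraction, `cur + (W - cur)` is the maximum of `cur` and `W`.
  have hv : (Expr.add (.reg 9) (.add (.cell 2 (.reg 10))
      (.sub (valueExpr 8 10) (.cell 2 (.reg 10))))).eval s₂ =
      ∑ j ∈ range (t + 1), max (cur j) (intValue inp m n D (s.reg 8) j) := by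
    simp only [Expr.eval, hc₂.eval_valueExpr, h9₂, hx, hm₂, hcur, hr₂ 8 (by norm_num),
      sum_range_succ]
    omega
  refine Runs.assign hs₂ (by rw [hv]; exact (sum_le_mul ht hM).trans_lt hMb) ?_
  rw [hv]
  refine ⟨by simp [hx], (hc₂.reg _ _).reg _ _, hm₂, fun y hy => ?_, by simp⟩
  simp only
  rw [Function.update_of_ne (by omega), Function.update_of_ne (by omega), hr₂ y hy]

/-- Register `7` becomes a bidder with the largest gain. -/
def selectProg : Prog :=
  .seq (.seq (.assign 6 (.lit 0)) (.assign 7 (.lit 0))) (.forLoop 8 (.reg 2)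
    (.seq gainProg (.branch (.sub (.reg 9) (.reg 6))
      (.seq (.assign 6 (.reg 9)) (.assign 7 (.reg 8))) .skip)))

theorem selectProg_runs {b : ℕ} {inp : ℕ → ℕ} {m n K D : ℕ} (hb : WordLength b inp m n K D)
    {s : State} (hs : s.Bounded b) (hc : Ctx inp m n K D s) {cur : ℕ → ℕ} (hcur : s.mem 2 = cur)
    {M : ℕ} (hcM : ∀ j < m, cur j ≤ M) (hM : ∀ i < n, ∀ j < m, intValue inp m n D i j ≤ M)
    (hMb : m * M < 2 ^ b) :
    Runs b selectProg s fun s' => Ctx inp m n K D s' ∧ s'.mem = s.mem ∧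
      s'.reg 5 = s.reg 5 ∧ s'.reg 7 < n ∧
      ∀ i < n, ∑ j ∈ range m, max (cur j) (intValue inp m n D i j) ≤
        ∑ j ∈ range m, max (cur j) (intValue inp m n D (s'.reg 7) j) := by
  refine Runs.seq (R := fun s' => Ctx inp m n K D s' ∧ s'.mem = s.mem ∧
      s'.reg 5 = s.reg 5 ∧ s'.reg 6 = 0 ∧ s'.reg 7 = 0) ?_ ?_
  · refine Runs.seq (R := fun s' => Ctx inp m n K D s' ∧ s'.mem = s.mem ∧
      s'.reg 5 = s.reg 5 ∧ s'.reg 6 = 0)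
      (Runs.assign hs (Nat.two_pow_pos b) ⟨hc.reg _ _, rfl, by simp, by simp [Expr.eval]⟩) ?_
    rintro s₁ hs₁ ⟨hc₁, hm₁, h5, h6⟩
    exact Runs.assign hs₁ (Nat.two_pow_pos b)
      ⟨hc₁.reg _ _, hm₁, by simp [h5], by simp [h6], by simp [Expr.eval]⟩
  rintro s₁ hs₁ ⟨hc₁, hm₁, h5, h6, h7⟩
  set G : ℕ → ℕ := fun i => ∑ j ∈ range m, max (cur j) (intValue inp m n D i j) with hG
  -- The invariant has `reg 6 ≤ G (reg 7)` rather than equality, since register `6` starts at `0`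
  -- and not at `G 0`; the inequality suffices for maximality.
  refine Runs.forLoop (fun t s' => Ctx inp m n K D s' ∧ s'.mem = s.mem ∧
      s'.reg 5 = s.reg 5 ∧ s'.reg 7 < n ∧ s'.reg 6 ≤ G (s'.reg 7) ∧ ∀ i < t, G i ≤ s'.reg 6)
    n hs₁ hb.n_le ⟨hc₁.reg _ _, hm₁, by simp [h5], by simp [h7, hb.n_pos], by simp [h6], by simp⟩
    (fun t s h => h.1.reg_n) ?_ fun s' _ h => ⟨h.1, h.2.1, h.2.2.1, h.2.2.2.1, fun i hi =>
      (h.2.2.2.2.2 i hi).trans h.2.2.2.2.1⟩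
  rintro t ht s₂ hs₂ hx ⟨hc₂, hm₂, h5₂, h7₂, h6₂, hle⟩
  refine Runs.seq (gainProg_runs hb hs₂ hc₂ (by rw [hm₂, hcur])
    (fun j hj => max_le (hcM j hj) (hM _ (by rw [hx]; exact ht) j hj)) hMb) ?_
  rintro s₃ hs₃ ⟨hc₃, hm₃, hr₃, h9₃⟩
  rw [hx] at h9₃
  change _ = G t at h9₃
  have h5₃ := hr₃ 5 (by norm_num)
  have h6₃ := hr₃ 6 (by norm_num)
  have h7₃ := hr₃ 7 (by norm_num)
  have h8₃ := hr₃ 8 (by norm_num)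
  refine Runs.branch hs₃ (fun h => ?_) fun h => ?_
  · simp only [Expr.eval, h9₃, h6₃] at h
    refine Runs.seq (R := fun s' => Ctx inp m n K D s' ∧ s'.mem = s.mem ∧
      s'.reg 5 = s.reg 5 ∧ s'.reg 6 = G t ∧ s'.reg 8 = t)
      (Runs.assign hs₃ (hs₃.1 9) ⟨hc₃.reg _ _, by rw [hm₃, hm₂], by simp [h5₃, h5₂],
        by simp [Expr.eval, h9₃], by simp [h8₃, hx]⟩) ?_
    rintro s₄ hs₄ ⟨hc₄, hm₄, h5₄, h6₄, h8₄⟩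
    refine Runs.assign hs₄ (hs₄.1 8) ⟨by simp [h8₄], (hc₄.reg _ _).reg _ _, hm₄, by simp [h5₄],
      by simpa [Expr.eval, h8₄] using ht, by simp [Expr.eval, h8₄, h6₄], fun i hi => ?_⟩
    simp only [Function.update_apply]
    norm_num
    rw [h6₄]
    rcases Nat.lt_succ_iff_lt_or_eq.1 hi with hi' | rfl
    · have := hle i hi'; omega
    · exact le_rfl
  · simp only [Expr.eval, h9₃, h6₃] at h
    refine Runs.skip hs₃ ⟨by rw [h8₃, hx], hc₃.reg _ _, by rw [hm₃, hm₂], by simp [h5₃, h5₂],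
      by simpa [h7₃] using h7₂, by simpa [h6₃, h7₃] using h6₂, fun i hi => ?_⟩
    simp only [Function.update_apply]
    norm_num
    rw [h6₃]
    rcases Nat.lt_succ_iff_lt_or_eq.1 hi with hi' | rfl
    · exact hle i hi'
    · omega

/-- Reassign the categories that the bidder in register `7` values at least as much as their
owners. -/
def updateProg : Prog :=
  .forLoop 10 (.reg 1) (.branch (.sub (.add (valueExpr 7 10) (.lit 1)) (.cell 2 (.reg 10)))
    (.seq (.store 2 (.reg 10) (valueExpr 7 10)) (.store 1 (.reg 10) (.reg 7))) .skip)

theorem updateProg_runs {b : ℕ} {inp : ℕ → ℕ} {m n K D : ℕ} (hb : WordLength b inp m n K D)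
    {s : State} (hs : s.Bounded b) (hc : Ctx inp m n K D s) {cur own : ℕ → ℕ} {i : ℕ}
    (hi : s.reg 7 = i) (hown : s.mem 1 = own) (hcur : s.mem 2 = cur)
    (hM : ∀ j < m, intValue inp m n D i j < 2 ^ b) :
    Runs b updateProg s fun s' => Ctx inp m n K D s' ∧ s'.reg 5 = s.reg 5 ∧
      s'.mem 3 = s.mem 3 ∧ s'.mem 4 = s.mem 4 ∧
      (∀ j < m, cur j ≤ intValue inp m n D i j →
        s'.mem 2 j = intValue inp m n D i j ∧ s'.mem 1 j = i) ∧
      ∀ j < m, intValue inp m n D i j < cur j → s'.mem 2 j = cur j ∧ s'.mem 1 j = own j := by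
  subst hown hcur
  refine Runs.forLoop (fun t s' => (Ctx inp m n K D s' ∧ s'.reg 5 = s.reg 5 ∧ s'.reg 7 = i ∧
      s'.mem 3 = s.mem 3 ∧ s'.mem 4 = s.mem 4) ∧
      (∀ j, t ≤ j → s'.mem 2 j = s.mem 2 j ∧ s'.mem 1 j = s.mem 1 j) ∧
      (∀ j < t, s.mem 2 j ≤ intValue inp m n D i j →
        s'.mem 2 j = intValue inp m n D i j ∧ s'.mem 1 j = i) ∧
      ∀ j < t, intValue inp m n D i j < s.mem 2 j →
        s'.mem 2 j = s.mem 2 j ∧ s'.mem 1 j = s.mem 1 j) m hs hb.m_le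
    ⟨⟨hc.reg _ _, by simp, by simp [hi], rfl, rfl⟩, fun _ _ => ⟨rfl, rfl⟩, by simp, by simp⟩
    (fun t s h => h.1.1.reg_m) ?_ fun s' _ h =>
      ⟨h.1.1, h.1.2.1, h.1.2.2.2.1, h.1.2.2.2.2, h.2.2.1, h.2.2.2⟩
  rintro t ht s₂ hs₂ hx ⟨⟨hc₂, h5, h7, h3, h4⟩, hge, hle, hlt⟩
  have hv : (valueExpr 7 10).eval s₂ = intValue inp m n D i t := by
    rw [hc₂.eval_valueExpr, h7, hx]
  -- The guard `W + 1 - cur` is nonzero exactly when `cur ≤ W`, so ties are reassigned.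
  refine Runs.branch hs₂ (fun h => ?_) fun h => ?_
  · simp only [Expr.eval, hv, hx, (hge t le_rfl).1] at h
    refine Runs.seq (R := fun s' => Ctx inp m n K D s' ∧ s'.reg = s₂.reg ∧
      s'.mem = Function.update s₂.mem 2
        (Function.update (s₂.mem 2) t (intValue inp m n D i t)))
      (Runs.store hs₂ (by rw [hv]; exact hM t ht)
        ⟨hc₂.mem _ _, rfl, by rw [hv]; simp [Expr.eval, hx]⟩) ?_
    rintro s₃ hs₃ ⟨hc₃, hr₃, hm₃⟩
    refine Runs.store hs₃ (hs₃.1 7) ⟨by simp [hr₃, hx], ⟨(hc₃.mem _ _).reg _ _, by simp [hr₃, h5],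
      by simp [hr₃, h7], by simp [hm₃, h3], by simp [hm₃, h4]⟩, fun j hj => ?_, fun j hj hj' => ?_,
      fun j hj hj' => ?_⟩
    · have : j ≠ t := by omega
      simpa [Expr.eval, hm₃, hr₃, hx, this] using hge j (by omega)
    · by_cases hjt : j = t
      · subst hjt; simp [Expr.eval, hm₃, hr₃, hx, h7]
      · simpa [Expr.eval, hm₃, hr₃, hx, hjt] using hle j (by omega) hj'
    · have : j ≠ t := by rintro rfl; omega
      simpa [Expr.eval, hm₃, hr₃, hx, this] using hlt j (by omega) hj'
  · simp only [Expr.eval, hv, hx, (hge t le_rfl).1] at h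
    refine Runs.skip hs₂ ⟨hx, ⟨hc₂.reg _ _, by simp [h5], by simp [h7], h3, h4⟩,
      fun j hj => hge j (by omega), fun j hj hj' => ?_, fun j hj hj' => ?_⟩
    · exact hle j (by by_contra! hh; obtain rfl : j = t := by omega
                      omega) hj'
    · by_cases hjt : j = t
      · subst hjt; exact hge j le_rfl
      · exact hlt j (by omega) hj'

/-- The greedy algorithm. -/
def greedyProg : Prog := .forLoop 5 (.div (.reg 1) (.reg 3)) (.seq selectProg updateProg)

theorem greedyProg_runs {b : ℕ} {inp : ℕ → ℕ} {m n K D : ℕ} (hb : WordLength b inp m n K D)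
    {s : State} (hs : s.Bounded b) (hc : Ctx inp m n K D s) (hmem : ∀ a ≠ 0, s.mem a = fun _ => 0) :
    Runs b greedyProg s fun s' => Ctx inp m n K D s' ∧
      s'.mem 3 = (fun _ => 0) ∧ s'.mem 4 = (fun _ => 0) ∧
      GreedyInv (intValue inp m n D) m n (m / K) (m / K) (s'.mem 2) (s'.mem 1) := by
  obtain ⟨M, hM, hMb⟩ := hb.sum_lt
  have hk : 0 < m / K := Nat.div_pos hb.K_le hb.K_pos
  refine Runs.forLoop (fun t s' => Ctx inp m n K D s' ∧
      s'.mem 3 = (fun _ => 0) ∧ s'.mem 4 = (fun _ => 0) ∧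
      GreedyInv (intValue inp m n D) m n (m / K) t (s'.mem 2) (s'.mem 1)) (m / K) hs
    ((Nat.div_le_self m K).trans hb.m_le)
    ⟨hc.reg _ _, hmem 3 (by norm_num), hmem 4 (by norm_num), ?_⟩
    (fun t s h => by simp [Expr.eval, h.1.reg_m, h.1.reg_K]) ?_ fun s' _ h => h
  · rw [show s.mem 1 = _ from hmem 1 (by norm_num), show s.mem 2 = _ from hmem 2 (by norm_num)]
    exact greedyInv_zero _ _ hb.n_pos
  rintro t ht s₁ hs₁ hx ⟨hc₁, h3, h4, hI⟩
  refine Runs.seq (selectProg_runs hb hs₁ hc₁ rfl (hI.cur_le hM) hM hMb) ?_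
  rintro s₂ hs₂ ⟨hc₂, hm₂, h5₂, h7₂, hmax⟩
  refine (updateProg_runs hb hs₂ hc₂ rfl rfl rfl fun j hj => ?_).mono ?_
  · exact ((Nat.le_mul_of_pos_left M (by omega)).trans' (hM _ h7₂ j hj)).trans_lt hMb
  rintro s₃ hs₃ ⟨hc₃, h5₃, h3₃, h4₃, hle, hlt⟩
  refine ⟨by rw [h5₃, h5₂, hx], hc₃.reg _ _, by rw [h3₃, hm₂, h3], by rw [h4₃, hm₂, h4], ?_⟩
  rw [hm₂] at hle hlt
  exact hI.step hk h7₂ hmax hle hlt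

/-! ### The repair program. -/

/-- Count the categories of every owner, in the arrays `3` and `4`. -/
def countProg : Prog :=
  .forLoop 9 (.reg 1) (.seq
    (.store 3 (.cell 1 (.reg 9)) (.add (.cell 3 (.cell 1 (.reg 9))) (.lit 1)))
    (.store 4 (.cell 1 (.reg 9)) (.add (.cell 4 (.cell 1 (.reg 9))) (.lit 1))))

theorem update_count (own : ℕ → ℕ) (t : ℕ) :
    Function.update (count own t) (own t) (count own t (own t) + 1) = count own (t + 1) := by
  funext i
  rw [count_succ]
  by_cases h : i = own t
  · subst h; simp
  · rw [Function.update_of_ne h, if_neg (Ne.symm h), add_zero]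

/-- Two copies are needed: array `3` preserves the original counts, which decide who is large, while
array `4` is updated during filling. -/
theorem countProg_runs {b : ℕ} {inp : ℕ → ℕ} {m n K D : ℕ} (hb : WordLength b inp m n K D)
    {s : State} (hs : s.Bounded b) (hc : Ctx inp m n K D s)
    (h3 : s.mem 3 = fun _ => 0) (h4 : s.mem 4 = fun _ => 0) :
    Runs b countProg s fun s' => Ctx inp m n K D s' ∧ s'.mem 1 = s.mem 1 ∧ s'.mem 2 = s.mem 2 ∧
      s'.mem 3 = count (s.mem 1) m ∧ s'.mem 4 = count (s.mem 1) m := by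
  have hmb : b < 2 ^ b := Nat.lt_two_pow_self
  have hml := hb.m_le
  have h0 : count (s.mem 1) 0 = fun _ => 0 := by funext i; simp [count]
  refine Runs.forLoop (fun t s' => Ctx inp m n K D s' ∧ s'.mem 1 = s.mem 1 ∧ s'.mem 2 = s.mem 2 ∧
      s'.mem 3 = count (s.mem 1) t ∧ s'.mem 4 = count (s.mem 1) t) m hs hb.m_le
    ⟨hc.reg _ _, rfl, rfl, by rw [h0]; exact h3, by rw [h0]; exact h4⟩
    (fun t s h => h.1.reg_m) ?_ fun s' _ h => h
  rintro t ht s₁ hs₁ hx ⟨hc₁, h1, h2, h3, h4⟩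
  have hlt : count (s.mem 1) t (s.mem 1 t) + 1 < 2 ^ b := by
    have := count_le (s.mem 1) t (s.mem 1 t); omega
  refine Runs.seq (R := fun s' => Ctx inp m n K D s' ∧ s'.reg 9 = t ∧ s'.mem 1 = s.mem 1 ∧
      s'.mem 2 = s.mem 2 ∧ s'.mem 3 = count (s.mem 1) (t + 1) ∧ s'.mem 4 = count (s.mem 1) t)
    (Runs.store hs₁ (by simpa [Expr.eval, hx, h1, h3] using hlt)
      ⟨hc₁.mem _ _, hx, by simp [h1], by simp [h2], ?_, by simp [h4]⟩) ?_
  · simp [Expr.eval, hx, h1, h3, update_count]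
  rintro s₂ hs₂ ⟨hc₂, hx₂, h1₂, h2₂, h3₂, h4₂⟩
  refine Runs.store hs₂ (by simpa [Expr.eval, hx₂, h1₂, h4₂] using hlt)
      ⟨by simp [hx₂], (hc₂.mem _ _).reg _ _, by simp [h1₂], by simp [h2₂], by simp [h3₂], ?_⟩
  simp [Expr.eval, hx₂, h1₂, h4₂, update_count]

/-- Registers `5` and `6` become the values of the large and of the small owners, register `7`
the successor of a large owner or `0`, register `8` a small owner. -/
def splitProg : Prog :=
  .seq (.seq (.assign 5 (.lit 0)) (.seq (.assign 6 (.lit 0)) (.assign 7 (.lit 0))))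
    (.forLoop 9 (.reg 1)
      (.branch (.sub (.reg 3) (.cell 3 (.cell 1 (.reg 9))))
        (.seq (.assign 6 (.add (.reg 6) (.cell 2 (.reg 9)))) (.assign 8 (.cell 1 (.reg 9))))
        (.seq (.assign 5 (.add (.reg 5) (.cell 2 (.reg 9))))
          (.assign 7 (.add (.cell 1 (.reg 9)) (.lit 1))))))

theorem sum_filter_range_succ (p : ℕ → Prop) [DecidablePred p] (g : ℕ → ℕ) (t : ℕ) :
    ∑ j ∈ (range (t + 1)).filter p, g j =
      ∑ j ∈ (range t).filter p, g j + if p t then g t else 0 := by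
  rw [sum_filter, sum_range_succ, ← sum_filter]

theorem splitProg_runs {b : ℕ} {inp : ℕ → ℕ} {m n K D : ℕ} (hb : WordLength b inp m n K D)
    {s : State} (hs : s.Bounded b) (hc : Ctx inp m n K D s) {own cur : ℕ → ℕ}
    (h1 : s.mem 1 = own) (h2 : s.mem 2 = cur) (h3 : s.mem 3 = count own m)
    (hown : ∀ j < m, own j < n) {M : ℕ} (hM : ∀ j < m, cur j ≤ M) (hMb : m * M < 2 ^ b) :
    Runs b splitProg s fun s' => Ctx inp m n K D s' ∧ s'.mem = s.mem ∧
      s'.reg 5 = ∑ j ∈ (range m).filter (fun j => K ≤ count own m (own j)), cur j ∧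
      s'.reg 6 = ∑ j ∈ (range m).filter (fun j => count own m (own j) < K), cur j ∧
      (s'.reg 7 = 0 → ∀ j < m, count own m (own j) < K) ∧
      (s'.reg 7 ≠ 0 → s'.reg 7 - 1 < n ∧ K ≤ count own m (s'.reg 7 - 1)) ∧
      ((∃ j < m, count own m (own j) < K) →
        s'.reg 8 < n ∧ 0 < count own m (s'.reg 8) ∧ count own m (s'.reg 8) < K) := by
  have hmb : b < 2 ^ b := Nat.lt_two_pow_self
  have hnl := hb.n_le
  have hsum : ∀ (p : ℕ → Prop) [DecidablePred p], ∀ t ≤ m,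
      ∑ j ∈ (range t).filter p, cur j < 2 ^ b := fun p _ t ht =>
    ((sum_le_sum_of_subset (filter_subset p (range t))).trans (sum_le_mul ht hM)).trans_lt hMb
  refine Runs.seq (R := fun s' => Ctx inp m n K D s' ∧ s'.mem = s.mem ∧ s'.reg 5 = 0 ∧
    s'.reg 6 = 0 ∧ s'.reg 7 = 0) ?_ ?_
  · refine Runs.seq (R := fun s' => Ctx inp m n K D s' ∧ s'.mem = s.mem ∧ s'.reg 5 = 0)
      (Runs.assign hs (Nat.two_pow_pos b) ⟨hc.reg _ _, rfl, by simp [Expr.eval]⟩) ?_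
    rintro s₁ hs₁ ⟨hc₁, hm₁, h5⟩
    refine Runs.seq (R := fun s' => Ctx inp m n K D s' ∧ s'.mem = s.mem ∧ s'.reg 5 = 0 ∧
      s'.reg 6 = 0) (Runs.assign hs₁ (Nat.two_pow_pos b)
        ⟨hc₁.reg _ _, hm₁, by simp [h5], by simp [Expr.eval]⟩) ?_
    rintro s₂ hs₂ ⟨hc₂, hm₂, h5, h6⟩
    exact Runs.assign hs₂ (Nat.two_pow_pos b)
        ⟨hc₂.reg _ _, hm₂, by simp [h5], by simp [h6], by simp [Expr.eval]⟩
  rintro s₁ hs₁ ⟨hc₁, hm₁, h5, h6, h7⟩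
  refine Runs.forLoop (fun t s' => (Ctx inp m n K D s' ∧ s'.mem = s.mem) ∧
      s'.reg 5 = ∑ j ∈ (range t).filter (fun j => K ≤ count own m (own j)), cur j ∧
      s'.reg 6 = ∑ j ∈ (range t).filter (fun j => count own m (own j) < K), cur j ∧
      (s'.reg 7 = 0 → ∀ j < t, count own m (own j) < K) ∧
      (s'.reg 7 ≠ 0 → s'.reg 7 - 1 < n ∧ K ≤ count own m (s'.reg 7 - 1)) ∧
      ((∃ j < t, count own m (own j) < K) →
        s'.reg 8 < n ∧ 0 < count own m (s'.reg 8) ∧ count own m (s'.reg 8) < K)) m hs₁ hb.m_le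
    ⟨⟨hc₁.reg _ _, hm₁⟩, by simp [h5], by simp [h6], by simp, by simp [h7], by simp⟩
    (fun t s h => h.1.1.reg_m) ?_ fun s' _ h => ⟨h.1.1, h.1.2, h.2⟩
  rintro t ht s₂ hs₂ hx ⟨⟨hc₂, hm₂⟩, h5, h6, h7, h7', h8⟩
  have hot := hown t ht
  refine Runs.branch hs₂ (fun h => ?_) fun h => ?_
  · have hK : count own m (own t) < K := by
      simp only [Expr.eval, hc₂.reg_K, hx, hm₂, h1, h3] at h
      omega
    have hv : (Expr.add (.reg 6) (.cell 2 (.reg 9))).eval s₂ =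
        ∑ j ∈ (range (t + 1)).filter (fun j => count own m (own j) < K), cur j := by
      rw [sum_filter_range_succ, if_pos hK]
      simp [Expr.eval, h6, hx, hm₂, h2]
    refine Runs.seq (R := fun s' => (Ctx inp m n K D s' ∧ s'.mem = s.mem) ∧
        s'.reg 5 = s₂.reg 5 ∧ s'.reg 6 = (Expr.add (.reg 6) (.cell 2 (.reg 9))).eval s₂ ∧
        s'.reg 7 = s₂.reg 7 ∧ s'.reg 9 = t)
      (Runs.assign hs₂ (by rw [hv]; exact hsum _ _ ht) ⟨⟨hc₂.reg _ _, hm₂⟩, by simp, by simp,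
        by simp, by simp [hx]⟩) ?_
    rintro s₃ hs₃ ⟨⟨hc₃, hm₃⟩, h5₃, h6₃, h7₃, hx₃⟩
    refine Runs.assign hs₃ (by simp [Expr.eval, hx₃, hm₃, h1]; omega)
      ⟨by simp [hx₃], ⟨(hc₃.reg _ _).reg _ _, hm₃⟩, ?_, by simp [h6₃, hv], ?_, ?_, fun _ => ?_⟩
    · rw [sum_filter_range_succ, if_neg (by omega)]
      simp [h5₃, h5]
    · simp only [Function.update_apply]
      norm_num
      intro h70 j hj
      rcases Nat.lt_or_eq_of_le hj with hj' | rfl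
      · exact h7 (by rw [← h7₃, h70]) j hj'
      · exact hK
    · simpa [h7₃] using h7'
    · simpa [Expr.eval, hx₃, hm₃, h1] using ⟨hot, count_pos ht, hK⟩
  · have hK : K ≤ count own m (own t) := by
      simp only [Expr.eval, hc₂.reg_K, hx, hm₂, h1, h3] at h
      omega
    have hv : (Expr.add (.reg 5) (.cell 2 (.reg 9))).eval s₂ =
        ∑ j ∈ (range (t + 1)).filter (fun j => K ≤ count own m (own j)), cur j := by
      rw [sum_filter_range_succ, if_pos hK]
      simp [Expr.eval, h5, hx, hm₂, h2]
    refine Runs.seq (R := fun s' => (Ctx inp m n K D s' ∧ s'.mem = s.mem) ∧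
        s'.reg 6 = s₂.reg 6 ∧ s'.reg 5 = (Expr.add (.reg 5) (.cell 2 (.reg 9))).eval s₂ ∧
        s'.reg 8 = s₂.reg 8 ∧ s'.reg 9 = t)
      (Runs.assign hs₂ (by rw [hv]; exact hsum _ _ ht) ⟨⟨hc₂.reg _ _, hm₂⟩, by simp, by simp,
        by simp, by simp [hx]⟩) ?_
    rintro s₃ hs₃ ⟨⟨hc₃, hm₃⟩, h6₃, h5₃, h8₃, hx₃⟩
    refine Runs.assign hs₃ (by simp [Expr.eval, hx₃, hm₃, h1]; omega)
      ⟨by simp [hx₃], ⟨(hc₃.reg _ _).reg _ _, hm₃⟩, by simp [h5₃, hv], ?_, ?_, ?_, ?_⟩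
    · rw [sum_filter_range_succ, if_neg (by omega)]
      simp [h6₃, h6]
    · simp [Expr.eval]
    · simpa [Expr.eval, hx₃, hm₃, h1] using ⟨hot, hK⟩
    · rintro ⟨j, hj, hjK⟩
      have hjt : j < t := by
        by_contra! hh
        obtain rfl : j = t := by omega
        omega
      simpa [h8₃] using h8 ⟨j, hjt, hjK⟩

/-- Give the categories of all small owners to one large owner. -/
def mergeProg : Prog :=
  .forLoop 9 (.reg 1) (.branch (.sub (.reg 3) (.cell 3 (.cell 1 (.reg 9))))
    (.store 1 (.reg 9) (.sub (.reg 7) (.lit 1))) .skip)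

theorem mergeProg_runs {b : ℕ} {inp : ℕ → ℕ} {m n K D : ℕ} (hb : WordLength b inp m n K D)
    {s : State} (hs : s.Bounded b) (hc : Ctx inp m n K D s) {own : ℕ → ℕ}
    (h1 : s.mem 1 = own) (h3 : s.mem 3 = count own m) :
    Runs b mergeProg s fun s' => Ctx inp m n K D s' ∧
      (∀ j < m, K ≤ count own m (own j) → s'.mem 1 j = own j) ∧
      ∀ j < m, count own m (own j) < K → s'.mem 1 j = s.reg 7 - 1 := by
  refine Runs.forLoop (fun t s' => (Ctx inp m n K D s' ∧ s'.mem 3 = count own m ∧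
      s'.reg 7 = s.reg 7) ∧ (∀ j, t ≤ j → s'.mem 1 j = own j) ∧
      (∀ j < t, K ≤ count own m (own j) → s'.mem 1 j = own j) ∧
      ∀ j < t, count own m (own j) < K → s'.mem 1 j = s.reg 7 - 1) m hs hb.m_le
    ⟨⟨hc.reg _ _, h3, by simp⟩, by simp [h1], by simp, by simp⟩
    (fun t s h => h.1.1.reg_m) ?_ fun s' _ h => ⟨h.1.1, h.2.2⟩
  rintro t ht s₁ hs₁ hx ⟨⟨hc₁, h3₁, h7₁⟩, hge, hl, hsm⟩
  have hb7 : s₁.reg 7 - 1 < 2 ^ b := (Nat.sub_le _ _).trans_lt (hs₁.1 7)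
  refine Runs.branch hs₁ (fun h => ?_) fun h => ?_
  · simp only [Expr.eval, hc₁.reg_K, hx, h3₁, hge t le_rfl] at h
    refine Runs.store hs₁ hb7 ⟨hx, ⟨(hc₁.mem _ _).reg _ _, by simp [h3₁], by simp [h7₁]⟩,
      fun j hj => ?_, fun j hj hK => ?_, fun j hj hK => ?_⟩
    · have : j ≠ t := by omega
      simpa [Expr.eval, hx, this] using hge j (by omega)
    · have : j ≠ t := by rintro rfl; omega
      simpa [Expr.eval, hx, this] using hl j (by omega) hK
    · by_cases hjt : j = t
      · subst hjt; simp [Expr.eval, hx, h7₁]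
      · simpa [Expr.eval, hx, hjt] using hsm j (by omega) hK
  · simp only [Expr.eval, hc₁.reg_K, hx, h3₁, hge t le_rfl] at h
    refine Runs.skip hs₁ ⟨hx, ⟨hc₁.reg _ _, h3₁, by simp [h7₁]⟩, fun j hj => hge j (by omega),
      fun j hj hK => ?_, fun j hj hK => ?_⟩
    · by_cases hjt : j = t
      · exact hge j (by omega)
      · exact hl j (by omega) hK
    · exact hsm j (by by_contra! hh; obtain rfl : j = t := by omega
                      omega) hK

/-- Register `10` becomes an owner in use with a deficient counter if there is one, and otherwise
the owner in register `8`. -/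
def targetProg : Prog :=
  .seq (.assign 10 (.reg 8)) (.forLoop 11 (.reg 2)
    (.branch (.mul (.sub (.reg 3) (.cell 4 (.reg 11))) (.cell 3 (.reg 11)))
      (.assign 10 (.reg 11)) .skip))

/-- The product in the guard is a conjunction. Bidders with zero count are excluded because opening
new signals could break the bound on the number of owners times `K`. -/
theorem targetProg_runs {b : ℕ} {inp : ℕ → ℕ} {m n K D : ℕ} (hb : WordLength b inp m n K D)
    {s : State} (hs : s.Bounded b) (hc : Ctx inp m n K D s) {cnt c : ℕ → ℕ}
    (h3 : s.mem 3 = cnt) (h4 : s.mem 4 = c) :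
    Runs b targetProg s fun s' => Ctx inp m n K D s' ∧ s'.mem = s.mem ∧ s'.reg 8 = s.reg 8 ∧
      s'.reg 9 = s.reg 9 ∧
      (s'.reg 10 = s.reg 8 ∨ s'.reg 10 < n ∧ 0 < cnt (s'.reg 10) ∧ c (s'.reg 10) < K) ∧
      ((∃ i < n, 0 < cnt i ∧ c i < K) → c (s'.reg 10) < K) := by
  refine Runs.seq (R := fun s' => Ctx inp m n K D s' ∧ s'.mem = s.mem ∧ s'.reg 8 = s.reg 8 ∧
      s'.reg 9 = s.reg 9 ∧ s'.reg 10 = s.reg 8)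
    (Runs.assign hs (hs.1 8) ⟨hc.reg _ _, rfl, by simp, by simp, by simp [Expr.eval]⟩) ?_
  rintro s₁ hs₁ ⟨hc₁, hm₁, h8, h9, h10⟩
  refine Runs.forLoop (fun t s' => (Ctx inp m n K D s' ∧ s'.mem = s.mem ∧ s'.reg 8 = s.reg 8 ∧
      s'.reg 9 = s.reg 9) ∧
      (s'.reg 10 = s.reg 8 ∨ s'.reg 10 < n ∧ 0 < cnt (s'.reg 10) ∧ c (s'.reg 10) < K) ∧
      ((∃ i < t, 0 < cnt i ∧ c i < K) → c (s'.reg 10) < K)) n hs₁ hb.n_le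
    ⟨⟨hc₁.reg _ _, hm₁, by simp [h8], by simp [h9]⟩, by simp [h10], by simp⟩
    (fun t s h => h.1.1.reg_n) ?_ fun s' _ h => ⟨h.1.1, h.1.2.1, h.1.2.2.1, h.1.2.2.2, h.2⟩
  rintro t ht s₂ hs₂ hx ⟨⟨hc₂, hm₂, h8, h9⟩, hor, hd⟩
  refine Runs.branch hs₂ (fun h => ?_) fun h => ?_
  · simp only [Expr.eval, hc₂.reg_K, hx, hm₂, h3, h4] at h
    have h0 : 0 < cnt t := Nat.pos_of_ne_zero (right_ne_zero_of_mul h)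
    have hK : c t < K := by have := left_ne_zero_of_mul h; omega
    refine Runs.assign hs₂ (hs₂.1 11) ⟨by simp [hx], ⟨(hc₂.reg _ _).reg _ _, hm₂, by simp [h8],
      by simp [h9]⟩, Or.inr ?_, fun _ => ?_⟩
    · simpa [Expr.eval, hx] using ⟨ht, h0, hK⟩
    · simpa [Expr.eval, hx] using hK
  · simp only [Expr.eval, hc₂.reg_K, hx, hm₂, h3, h4] at h
    refine Runs.skip hs₂ ⟨hx, ⟨hc₂.reg _ _, hm₂, by simp [h8], by simp [h9]⟩, by simpa using hor,
      ?_⟩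
    rintro ⟨i, hi, h0, hK⟩
    have hit : i < t := by
      by_contra! hh
      obtain rfl : i = t := by omega
      rcases Nat.mul_eq_zero.1 h with h | h <;> omega
    simpa using hd ⟨i, hit, h0, hK⟩

/-- Move the categories of all large owners to small owners. -/
def fillProg : Prog :=
  .forLoop 9 (.reg 1) (.branch (.sub (.reg 3) (.cell 3 (.cell 1 (.reg 9)))) .skip
    (.seq targetProg (.seq (.store 1 (.reg 9) (.reg 10))
      (.store 4 (.reg 10) (.add (.cell 4 (.reg 10)) (.lit 1))))))

theorem fillProg_runs {b : ℕ} {inp : ℕ → ℕ} {m n K D : ℕ} (hb : WordLength b inp m n K D)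
    {s : State} (hs : s.Bounded b) (hc : Ctx inp m n K D s) {own : ℕ → ℕ}
    (h1 : s.mem 1 = own) (h3 : s.mem 3 = count own m) (h4 : s.mem 4 = count own m)
    (hown : ∀ j < m, own j < n) (hl : s.reg 8 < n) (hl0 : 0 < count own m (s.reg 8))
    (hlK : count own m (s.reg 8) < K) :
    Runs b fillProg s fun s' => Ctx inp m n K D s' ∧
      FillInv m n K own m (s'.mem 1) (s'.mem 4) := by
  have hmb : b < 2 ^ b := Nat.lt_two_pow_self
  have hml := hb.m_le
  refine Runs.forLoop (fun t s' => (Ctx inp m n K D s' ∧ s'.mem 3 = count own m ∧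
      s'.reg 8 = s.reg 8) ∧ FillInv m n K own t (s'.mem 1) (s'.mem 4)) m hs hb.m_le
    ⟨⟨hc.reg _ _, h3, by simp⟩, by rw [show s.mem 1 = _ from h1, show s.mem 4 = _ from h4]
                                   exact fillInv_zero m n K own⟩
    (fun t s h => h.1.1.reg_m) ?_ fun s' _ h => ⟨h.1.1, h.2⟩
  rintro t ht s₁ hs₁ hx ⟨⟨hc₁, h3₁, h8₁⟩, hI⟩
  have hft := hI.rest t ht le_rfl
  refine Runs.branch hs₁ (fun h => ?_) fun h => ?_
  · simp only [Expr.eval, hc₁.reg_K, hx, h3₁, hft] at h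
    exact Runs.skip hs₁ ⟨hx, ⟨hc₁.reg _ _, h3₁, by simp [h8₁]⟩,
      hI.step_keep ht (hown t ht) (by omega)⟩
  · simp only [Expr.eval, hc₁.reg_K, hx, h3₁, hft] at h
    refine Runs.seq (targetProg_runs hb hs₁ hc₁ h3₁ rfl) ?_
    rintro s₂ hs₂ ⟨hc₂, hm₂, h8₂, h9₂, hor, hd⟩
    have ha : s₂.reg 10 < n ∧ 0 < count own m (s₂.reg 10) ∧ count own m (s₂.reg 10) < K := by
      rcases hor with hor | ⟨hn, h0, hK⟩
      · rw [hor, h8₁]; exact ⟨hl, hl0, hlK⟩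
      · refine ⟨hn, h0, ?_⟩
        by_contra! hh
        have := hI.large _ hh
        omega
    refine Runs.seq (R := fun s' => (Ctx inp m n K D s' ∧ s'.mem 3 = count own m ∧
        s'.reg = s₂.reg) ∧ s'.mem 1 = Function.update (s₁.mem 1) t (s₂.reg 10) ∧
        s'.mem 4 = s₁.mem 4) (Runs.store hs₂ (hs₂.1 10) ⟨⟨hc₂.mem _ _, by simp [hm₂, h3₁], rfl⟩,
          by simp [Expr.eval, h9₂, hx, hm₂], by simp [hm₂]⟩) ?_
    rintro s₃ hs₃ ⟨⟨hc₃, h3₃, hr₃⟩, h1₃, h4₃⟩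
    refine Runs.store hs₃ ?_ ⟨by simp [hr₃, h9₂, hx], ⟨(hc₃.mem _ _).reg _ _, by simp [h3₃],
      by simp [hr₃, h8₂, h8₁]⟩, ?_⟩
    · have h5 := hI.small _ ha.2.2
      -- The incremented counter fits in a word: category `t` still belongs to a large owner and the
      -- target is small, so the target does not own everything.
      have h6 : count (s₁.mem 1) m (s₂.reg 10) < m := by
        by_contra! hh
        have hle := count_le (s₁.mem 1) m (s₂.reg 10)
        have heq : (range m).filter (fun j => s₁.mem 1 j = s₂.reg 10) = range m :=
          eq_of_subset_of_card_le (filter_subset _ _) (by rw [card_range]; exact hh)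
        have h7 : t ∈ (range m).filter (fun j => s₁.mem 1 j = s₂.reg 10) := by
          rw [heq]; exact mem_range.2 ht
        rw [mem_filter, hft] at h7
        rw [h7.2] at h
        omega
      simp only [Expr.eval, hr₃, h4₃]
      omega
    · have := hI.step_move ht (by omega) ha.1 ha.2.1 ha.2.2 hd hown
      simpa [Expr.eval, hr₃, h1₃, h4₃] using this

/-- Turn the greedy assignment into a `K`-anonymous one. -/
def repairProg : Prog :=
  .seq countProg (.seq splitProg
    (.branch (.mul (.reg 7) (.sub (.add (.reg 5) (.lit 1)) (.reg 6))) mergeProg fillProg))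

theorem repairProg_runs {b : ℕ} {inp : ℕ → ℕ} {m n K D : ℕ} (hb : WordLength b inp m n K D)
    {s : State} (hs : s.Bounded b) (hc : Ctx inp m n K D s) {own : ℕ → ℕ}
    (h1 : s.mem 1 = own) (h2 : ∀ j < m, s.mem 2 j = intValue inp m n D (own j) j)
    (h3 : s.mem 3 = fun _ => 0) (h4 : s.mem 4 = fun _ => 0) (hown : ∀ j < m, own j < n)
    (hk : ((range m).image own).card * K ≤ m) :
    Runs b repairProg s fun s' => Ctx inp m n K D s' ∧
      Repaired (intValue inp m n D) m n K own (s'.mem 1) := by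
  obtain ⟨M, hM, hMb⟩ := hb.sum_lt
  refine Runs.seq (countProg_runs hb hs hc h3 h4) ?_
  rintro s₁ hs₁ ⟨hc₁, h1₁, h2₁, h3₁, h4₁⟩
  rw [h1] at h1₁ h3₁ h4₁
  refine Runs.seq (splitProg_runs hb hs₁ hc₁ h1₁ h2₁ h3₁ hown
    (fun j hj => by rw [h2 j hj]; exact hM _ (hown j hj) j hj) hMb) ?_
  rintro s₂ hs₂ ⟨hc₂, hm₂, h5, h6, h7, h7', h8⟩
  have hsum : ∀ (p : ℕ → Prop) [DecidablePred p], ∑ j ∈ (range m).filter p, s.mem 2 j =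
      ∑ j ∈ (range m).filter p, intValue inp m n D (own j) j := fun p _ =>
    sum_congr rfl fun j hj => h2 j (mem_range.1 (mem_filter.1 hj).1)
  rw [hsum] at h5 h6
  -- The guard is nonzero exactly when a large owner exists and the large owners are worth at least
  -- as much as the small ones.
  refine Runs.branch hs₂ (fun h => ?_) fun h => ?_
  · simp only [Expr.eval] at h
    have h0 := left_ne_zero_of_mul h
    have hle := right_ne_zero_of_mul h
    refine (mergeProg_runs hb hs₂ hc₂ (by rw [hm₂, h1₁]) (by rw [hm₂, h3₁])).mono ?_
    rintro s₃ hs₃ ⟨hc₃, hl, hsm⟩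
    refine ⟨hc₃, repaired_of_large hown (h7' h0).1 (h7' h0).2 hl hsm ?_⟩
    simp only [not_le]
    omega
  · simp only [Expr.eval] at h
    -- Filling needs a small owner to fill. Either no owner is large, or the small owners are worth
    -- strictly more than the large ones and hence exist.
    have hle : s₂.reg 5 ≤ s₂.reg 6 ∧ ∃ j < m, count own m (own j) < K := by
      rcases Nat.mul_eq_zero.1 h with h | h
      · refine ⟨?_, 0, lt_of_lt_of_le hb.K_pos hb.K_le, h7 h _ (lt_of_lt_of_le hb.K_pos hb.K_le)⟩
        rw [h5, filter_false_of_mem fun j hj => not_le.2 (h7 h j (mem_range.1 hj)), sum_empty]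
        exact Nat.zero_le _
      · refine ⟨by omega, ?_⟩
        by_contra! hh
        rw [filter_false_of_mem fun j hj => not_lt.2 (hh j (mem_range.1 hj)), sum_empty] at h6
        omega
    obtain ⟨hl, hl0, hlK⟩ := h8 hle.2
    refine (fillProg_runs hb hs₂ hc₂ (by rw [hm₂, h1₁]) (by rw [hm₂, h3₁]) (by rw [hm₂, h4₁])
      hown hl hl0 hlK).mono ?_
    rintro s₃ hs₃ ⟨hc₃, hI⟩
    refine ⟨hc₃, hI.repaired hk ?_⟩
    simp only [not_lt]
    omega

/-! ### Output, initialization and the complete program. -/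

/-- Write the assignment to the output tape. -/
def outputProg : Prog := .forLoop 9 (.reg 1) (.output (.cell 1 (.reg 9)))

theorem outputProg_runs {b : ℕ} {inp : ℕ → ℕ} {m n K D : ℕ} (hb : WordLength b inp m n K D)
    {s : State} (hs : s.Bounded b) (hc : Ctx inp m n K D s) :
    Runs b outputProg s fun s' => s'.out = (List.range m).map (s.mem 1) := by
  refine Runs.forLoop (fun t s' => s'.reg 1 = m ∧ s'.mem = s.mem ∧
      s'.out = (List.range t).map (s.mem 1)) m hs hb.m_le
    ⟨by simp [hc.reg_m], rfl, by simp [hc.out_nil]⟩ (fun t s h => h.1) ?_ fun s' _ h => h.2.2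
  rintro t ht s₁ hs₁ hx ⟨h1, hm, ho⟩
  refine Runs.output hs₁ ⟨hx, by simp [h1], hm, ?_⟩
  simp [Expr.eval, hx, hm, ho, List.range_succ]

/-- Read the parameters and compute the product of all denominators. -/
def initProg : Prog :=
  .seq (.seq (.assign 1 (.cell 0 (.lit 0))) (.seq (.assign 2 (.cell 0 (.lit 1)))
    (.seq (.assign 3 (.cell 0 (.lit 2))) (.assign 4 (.lit 1)))))
  (.seq (.forLoop 5 (.reg 1) (.assign 4 (.mul (.reg 4)
      (.cell 0 (.add (.add (.lit 3) (.reg 1)) (.reg 5))))))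
    (.forLoop 5 (.mul (.reg 2) (.reg 1)) (.assign 4 (.mul (.reg 4) (.cell 0
      (.add (.add (.add (.lit 3) (.mul (.lit 2) (.reg 1))) (.mul (.reg 2) (.reg 1))) (.reg 5)))))))

/-- The product of all denominators in the input word. -/
def commonDen (inp : ℕ → ℕ) (m n : ℕ) : ℕ :=
  (∏ x ∈ range m, inp (3 + m + x)) * ∏ x ∈ range (n * m), inp (3 + 2 * m + n * m + x)

theorem initProg_runs {b : ℕ} {inp : ℕ → ℕ} {m n K : ℕ}
    (hb : WordLength b inp m n K (commonDen inp m n)) (hnm : n * m ≤ b)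
    (hD : commonDen inp m n < 2 ^ b) (hp : ∀ x < m, 0 < inp (3 + m + x))
    (hv : ∀ x < n * m, 0 < inp (3 + 2 * m + n * m + x)) {s : State} (hs : s.Bounded b)
    (hout : s.out = []) (hinp : s.mem 0 = inp) (h0 : inp 0 = m) (h1 : inp 1 = n) (h2 : inp 2 = K) :
    Runs b initProg s fun s' => Ctx inp m n K (commonDen inp m n) s' ∧ s'.mem = s.mem := by
  -- The denominators are positive, so every partial product is at most the full one and fits in a
  -- word.
  have hle : ∀ t ≤ m, ∀ u ≤ n * m, (∏ x ∈ range t, inp (3 + m + x)) *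
      ∏ x ∈ range u, inp (3 + 2 * m + n * m + x) ≤ commonDen inp m n := fun t ht u hu =>
    Nat.mul_le_mul
      (prod_le_prod_of_subset_of_one_le' (range_mono ht) fun i hi _ => hp i (mem_range.1 hi))
      (prod_le_prod_of_subset_of_one_le' (range_mono hu) fun i hi _ => hv i (mem_range.1 hi))
  have h1b : 1 < 2 ^ b := Nat.one_lt_two_pow (by
    have := hb.K_pos; have := hb.K_le; have := hb.m_le; omega)
  refine Runs.seq (R := fun s' => Ctx inp m n K 1 s' ∧ s'.mem = s.mem) ?_ ?_
  · refine Runs.seq (R := fun s' => (s'.mem = s.mem ∧ s'.out = []) ∧ s'.reg 1 = m)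
      (Runs.assign hs (hs.2 0 0) ⟨⟨rfl, hout⟩, by simp [Expr.eval, hinp, h0]⟩) ?_
    rintro s₁ hs₁ ⟨hm₁, hr₁⟩
    refine Runs.seq (R := fun s' => (s'.mem = s.mem ∧ s'.out = []) ∧ s'.reg 1 = m ∧ s'.reg 2 = n)
      (Runs.assign hs₁ (hs₁.2 0 1)
        ⟨hm₁, by simp [hr₁], by simp [Expr.eval, hm₁.1, hinp, h1]⟩) ?_
    rintro s₂ hs₂ ⟨hm₂, hr₂, hr₂'⟩
    refine Runs.seq (R := fun s' => (s'.mem = s.mem ∧ s'.out = []) ∧ s'.reg 1 = m ∧ s'.reg 2 = n ∧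
      s'.reg 3 = K) (Runs.assign hs₂ (hs₂.2 0 2)
        ⟨hm₂, by simp [hr₂], by simp [hr₂'], by simp [Expr.eval, hm₂.1, hinp, h2]⟩) ?_
    rintro s₃ hs₃ ⟨hm₃, hr₃, hr₃', hr₃''⟩
    exact Runs.assign hs₃ h1b ⟨⟨by simp [hr₃], by simp [hr₃'], by simp [hr₃''],
      by simp [Expr.eval], by simp [hm₃.1, hinp], hm₃.2⟩, hm₃.1⟩
  have hD' : ∀ {D D' : ℕ} {s : State}, Ctx inp m n K D s →
      Ctx inp m n K D' { s with reg := Function.update s.reg 4 D' } := fun h =>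
    ⟨by simp [h.reg_m], by simp [h.reg_n], by simp [h.reg_K], by simp, h.mem_inp, h.out_nil⟩
  rintro s₁ hs₁ ⟨hc₁, hm₁⟩
  refine Runs.seq (R := fun s' => Ctx inp m n K (∏ x ∈ range m, inp (3 + m + x)) s' ∧
    s'.mem = s.mem) ?_ ?_
  · refine Runs.forLoop (fun t s' => Ctx inp m n K (∏ x ∈ range t, inp (3 + m + x)) s' ∧
      s'.mem = s.mem) m hs₁ hb.m_le ⟨by simpa using hc₁.reg 5 0, hm₁⟩ (fun t s h => h.1.reg_m) ?_
      fun s' _ h => h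
    rintro t ht s₂ hs₂ hx ⟨hc₂, hm₂⟩
    have he : (Expr.mul (.reg 4) (.cell 0 (.add (.add (.lit 3) (.reg 1)) (.reg 5)))).eval s₂ =
        ∏ x ∈ range (t + 1), inp (3 + m + x) := by
      simp [Expr.eval, hc₂.reg_D, hc₂.reg_m, hx, hc₂.mem_inp, prod_range_succ]
    refine Runs.assign hs₂ ?_ ?_
    · rw [he]
      simpa using (hle (t + 1) ht 0 (Nat.zero_le _)).trans_lt hD
    · rw [he]
      exact ⟨by simp [hx], (hD' hc₂).reg _ _, hm₂⟩
  rintro s₂ hs₂ ⟨hc₂, hm₂⟩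
  refine Runs.forLoop (fun t s' => Ctx inp m n K ((∏ x ∈ range m, inp (3 + m + x)) *
      ∏ x ∈ range t, inp (3 + 2 * m + n * m + x)) s' ∧ s'.mem = s.mem) (n * m) hs₂ hnm
    ⟨by simpa using hc₂.reg 5 0, hm₂⟩ (fun t s h => by simp [Expr.eval, h.1.reg_m, h.1.reg_n]) ?_
    fun s' _ h => h
  rintro t ht s₃ hs₃ hx ⟨hc₃, hm₃⟩
  have he : (Expr.mul (.reg 4) (.cell 0 (.add (.add (.add (.lit 3) (.mul (.lit 2) (.reg 1)))
      (.mul (.reg 2) (.reg 1))) (.reg 5)))).eval s₃ = (∏ x ∈ range m, inp (3 + m + x)) *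
      ∏ x ∈ range (t + 1), inp (3 + 2 * m + n * m + x) := by
    simp [Expr.eval, hc₃.reg_D, hc₃.reg_m, hc₃.reg_n, hx, hc₃.mem_inp, prod_range_succ, mul_assoc]
  refine Runs.assign hs₃ ?_ ?_
  · rw [he]
    exact (hle m le_rfl (t + 1) ht).trans_lt hD
  · rw [he]
    exact ⟨by simp [hx], (hD' hc₃).reg _ _, hm₃⟩

/-- The approximation algorithm. -/
def mainProg : Prog := .seq initProg (.seq greedyProg (.seq repairProg outputProg))

theorem mainProg_runs {b : ℕ} {inp : ℕ → ℕ} {m n K : ℕ}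
    (hb : WordLength b inp m n K (commonDen inp m n)) (hnm : n * m ≤ b)
    (hD : commonDen inp m n < 2 ^ b) (hp : ∀ x < m, 0 < inp (3 + m + x))
    (hv : ∀ x < n * m, 0 < inp (3 + 2 * m + n * m + x)) {s : State} (hs : s.Bounded b)
    (hout : s.out = []) (hinp : s.mem 0 = inp) (hmem : ∀ a ≠ 0, s.mem a = fun _ => 0)
    (h0 : inp 0 = m) (h1 : inp 1 = n) (h2 : inp 2 = K) :
    Runs b mainProg s fun s' => ∃ f : ℕ → ℕ, s'.out = (List.range m).map f ∧
      (∀ j < m, f j < n) ∧ (∀ j < m, K ≤ count f m (f j)) ∧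
      ∀ τ : ℕ → ℕ, (∀ j < m, τ j < n) → ((range m).image τ).card ≤ m / K →
        (1 - 1 / Real.exp 1) * (∑ j ∈ range m, intValue inp m n (commonDen inp m n) (τ j) j : ℕ) ≤
          2 * (∑ j ∈ range m, intValue inp m n (commonDen inp m n) (f j) j : ℕ) := by
  have hk : 0 < m / K := Nat.div_pos hb.K_le hb.K_pos
  refine Runs.seq (initProg_runs hb hnm hD hp hv hs hout hinp h0 h1 h2) ?_
  rintro s₁ hs₁ ⟨hc₁, hm₁⟩
  refine Runs.seq (greedyProg_runs hb hs₁ hc₁ (by rw [hm₁]; exact hmem)) ?_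
  rintro s₂ hs₂ ⟨hc₂, h3, h4, hG⟩
  refine Runs.seq (repairProg_runs hb hs₂ hc₂ rfl (hG.cur_eq hk) h3 h4 hG.own_lt
    ((Nat.mul_le_mul_right K (hG.card_le hk)).trans (Nat.div_mul_le_self m K))) ?_
  rintro s₃ hs₃ ⟨hc₃, hR⟩
  refine (outputProg_runs hb hs₃ hc₃).mono fun s' _ ho => ⟨s₃.mem 1, ho, hR.lt, hR.le_count, ?_⟩
  intro τ hτ hcard
  have e1 := hG.value τ hτ hcard
  rw [sum_congr rfl fun j hj => hG.cur_eq hk j (mem_range.1 hj)] at e1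
  have e2 : ((∑ j ∈ range m, intValue inp m n (commonDen inp m n) (s₂.mem 1 j) j : ℕ) : ℝ) ≤
      2 * (∑ j ∈ range m, intValue inp m n (commonDen inp m n) (s₃.mem 1 j) j : ℕ) := by
    exact_mod_cast hR.value
  exact (mul_le_mul_of_nonneg_right (one_sub_inv_exp_le hk) (Nat.cast_nonneg _)).trans
    (e1.trans e2)

end Signaling

/-! ### Magnitudes in terms of the input length. -/

namespace Signaling

open RAM Finset

theorem inputSize_eq_sum (w : List ℕ) :
    inputSize w = ∑ x ∈ range w.length, ((w.getD x 0).size + 1) := by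
  induction w with
  | nil => rfl
  | cons a w ih =>
    rw [List.length_cons, sum_range_succ']
    simp only [List.getD_cons_succ, List.getD_cons_zero, ← ih]
    simp [inputSize, add_comm]

theorem length_le_inputSize (w : List ℕ) : w.length ≤ inputSize w := by
  rw [inputSize_eq_sum]
  calc w.length = ∑ _x ∈ range w.length, 1 := by simp
    _ ≤ _ := sum_le_sum fun _ _ => by omega

/-- Since `a + 1 ≤ 2 ^ a.size`, lengths add up where entries multiply; the extra one per entry in
`inputSize` makes the bound strict. -/
theorem prod_add_one_lt {w : List ℕ} (hw : 0 < w.length) :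
    ∏ x ∈ range w.length, (w.getD x 0 + 1) < 2 ^ inputSize w := by
  calc ∏ x ∈ range w.length, (w.getD x 0 + 1)
      ≤ ∏ x ∈ range w.length, 2 ^ (w.getD x 0).size :=
        prod_le_prod' fun x _ => Nat.lt_size_self _
    _ = 2 ^ ∑ x ∈ range w.length, (w.getD x 0).size := prod_pow_eq_pow_sum _ _ _
    _ < _ := Nat.pow_lt_pow_right (by norm_num) (by
        rw [inputSize_eq_sum, sum_add_distrib]
        simpa using hw)

/-- Adding one makes all factors positive, even for zero entries, so a product over a window is at
most the product over the whole word. -/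
theorem prod_getD_lt {w : List ℕ} (hw : 0 < w.length) {c N : ℕ} (h : c + N ≤ w.length) :
    ∏ x ∈ range N, w.getD (c + x) 0 < 2 ^ inputSize w := by
  refine lt_of_le_of_lt ?_ (prod_add_one_lt hw)
  calc ∏ x ∈ range N, w.getD (c + x) 0
      ≤ ∏ x ∈ range N, (w.getD (c + x) 0 + 1) := prod_le_prod' fun x _ => Nat.le_succ _
    _ ≤ (∏ x ∈ range c, (w.getD x 0 + 1)) * ∏ x ∈ range N, (w.getD (c + x) 0 + 1) :=
        Nat.le_mul_of_pos_left _ (prod_pos fun _ _ => Nat.succ_pos _)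
    _ = ∏ x ∈ range (c + N), (w.getD x 0 + 1) := (prod_range_add _ _ _).symm
    _ ≤ _ := prod_le_prod_of_subset_of_one_le' (range_mono h) fun _ _ _ => Nat.succ_pos _

theorem getD_lt (w : List ℕ) (x : ℕ) : w.getD x 0 < 2 ^ inputSize w := by
  by_cases h : x < w.length
  · simpa using prod_getD_lt (c := x) (N := 1) (by omega) h
  · rw [List.getD_eq_default _ _ (by omega)]
    exact Nat.two_pow_pos _

theorem bounded_initState (w : List ℕ) (r : List Bool) {b : ℕ} (hb : inputSize w ≤ b) :
    (initState w r).Bounded b := by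
  have hle : 2 ^ inputSize w ≤ 2 ^ b := Nat.pow_le_pow_right (by norm_num) hb
  have hlt : inputSize w < 2 ^ inputSize w := Nat.lt_two_pow_self
  have hl := length_le_inputSize w
  refine ⟨fun x => ?_, fun a i => ?_⟩ <;> simp only [initState] <;> split_ifs
  · omega
  · exact Nat.two_pow_pos b
  · exact (getD_lt w i).trans_le hle
  · exact Nat.two_pow_pos b

end Signaling

/-! ### Decoding the input and scaling to integers. -/

namespace SignalingInstance

open RAM Finset Signaling

variable (I : SignalingInstance)

/-- The cells of the input word. -/
def input (x : ℕ) : ℕ := I.encode.getD x 0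

theorem length_encode : I.encode.length = 3 + 2 * I.m + 2 * (I.n * I.m) := by
  simp [encode]; ring

theorem input_zero : I.input 0 = I.m := by simp [input, encode]

theorem input_one : I.input 1 = I.n := by simp [input, encode]

theorem input_two : I.input 2 = I.K := by simp [input, encode]

theorem getD_append_add {l₁ l₂ : List ℕ} {c x : ℕ} (h : l₁.length = c) :
    (l₁ ++ l₂).getD (c + x) 0 = l₂.getD x 0 := by
  rw [List.getD_append_right _ _ _ _ (by omega)]
  congr 1
  omega

theorem getD_ofFn {N : ℕ} (g : Fin N → ℕ) (x : Fin N) : (List.ofFn g).getD x 0 = g x := by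
  rw [List.getD_eq_getElem _ _ (by simp)]
  simp

theorem input_p_num (j : Fin I.m) : I.input (3 + j) = (I.p j).num := by
  rw [input, encode, List.append_assoc, List.append_assoc, List.append_assoc,
    getD_append_add (by simp), List.getD_append _ _ _ _ (by simp), getD_ofFn]

theorem input_p_den (j : Fin I.m) : I.input (3 + I.m + j) = (I.p j).den := by
  rw [input, encode, List.append_assoc, List.append_assoc,
    getD_append_add (by simp; omega), List.getD_append _ _ _ _ (by simp), getD_ofFn]

theorem input_v_num (x : Fin (I.n * I.m)) :
    I.input (3 + 2 * I.m + x) = (I.v x.divNat x.modNat).num := by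
  rw [input, encode, List.append_assoc,
    getD_append_add (by simp; omega), List.getD_append _ _ _ _ (by simp), getD_ofFn]

theorem input_v_den (x : Fin (I.n * I.m)) :
    I.input (3 + 2 * I.m + I.n * I.m + x) = (I.v x.divNat x.modNat).den := by
  rw [input, encode, getD_append_add (by simp; omega), getD_ofFn]

/-- The integral values of the instance. -/
def W (i j : ℕ) : ℕ := intValue I.input I.m I.n (commonDen I.input I.m I.n) i j

theorem commonDen_pos : 0 < commonDen I.input I.m I.n := by
  refine Nat.mul_pos (prod_pos fun x hx => ?_) (prod_pos fun x hx => ?_)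
  · rw [I.input_p_den ⟨x, mem_range.1 hx⟩]; exact NNRat.den_pos _
  · rw [I.input_v_den ⟨x, mem_range.1 hx⟩]; exact NNRat.den_pos _

/-- The denominator of `I.p j` divides the first factor of the common denominator and that of `I.v i
j` the second, so the integer division in `intValue` is exact. -/
theorem W_eq (i : Fin I.n) (j : Fin I.m) :
    (I.W i j : ℚ≥0) = commonDen I.input I.m I.n * (I.v i j * I.p j) := by
  have hm : 0 < I.m := j.pos
  have hx : i * I.m + j < I.n * I.m := by
    calc i * I.m + j < i * I.m + I.m := by omega
      _ = (i + 1) * I.m := by ring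
      _ ≤ _ := Nat.mul_le_mul_right _ i.2
  have hd : (⟨i * I.m + j, hx⟩ : Fin (I.n * I.m)).divNat = i := by
    ext
    simp [Fin.coe_divNat, add_comm (i.1 * I.m), Nat.add_mul_div_right _ _ hm]
  have hmod : (⟨i * I.m + j, hx⟩ : Fin (I.n * I.m)).modNat = j := by
    ext
    simp [Fin.coe_modNat, Nat.mod_eq_of_lt j.2]
  have h1 := I.input_v_num ⟨i * I.m + j, hx⟩
  have h2 := I.input_v_den ⟨i * I.m + j, hx⟩
  rw [hd, hmod] at h1 h2
  simp only at h1 h2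
  have hdvd : (I.v i j).den * (I.p j).den ∣ commonDen I.input I.m I.n := by
    rw [mul_comm, commonDen]
    refine mul_dvd_mul ?_ ?_
    · rw [← I.input_p_den j]
      exact dvd_prod_of_mem (fun x => I.input (3 + I.m + x)) (mem_range.2 j.2)
    · rw [← h2]
      exact dvd_prod_of_mem (fun x => I.input (3 + 2 * I.m + I.n * I.m + x)) (mem_range.2 hx)
  have hv0 : ((I.v i j).den : ℚ≥0) ≠ 0 := by exact_mod_cast NNRat.den_ne_zero _
  have hp0 : ((I.p j).den : ℚ≥0) ≠ 0 := by exact_mod_cast NNRat.den_ne_zero _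
  rw [W, intValue, h1, h2, I.input_p_num, I.input_p_den, Nat.cast_mul, Nat.cast_mul,
    Nat.cast_div hdvd (by push_cast; exact mul_ne_zero hv0 hp0)]
  conv_rhs => rw [← NNRat.num_div_den (I.v i j), ← NNRat.num_div_den (I.p j)]
  push_cast
  field_simp

/-! ### Welfare of schemes versus value of assignments. -/

variable {I}

theorem support_eq (f : I.Scheme) (S : ℕ) : support f S = univ.filter fun j => f j = S := by
  ext j
  simp [support, phi]

/-- For a signal of probability zero the conditional value is `0` by convention; all its categories
then have prior zero, so the right side vanishes too. -/
theorem signalProb_mul_condValue (f : I.Scheme) (i : Fin I.n) (S : ℕ) :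
    signalProb f S * condValue f i S = ∑ j with f j = S, I.v i j * I.p j := by
  have h : ∑ j, I.v i j * I.p j * phi f j S = ∑ j with f j = S, I.v i j * I.p j := by
    simp [phi, sum_filter]
  rw [condValue, h]
  by_cases h0 : signalProb f S = 0
  · rw [h0, zero_mul]
    refine (sum_eq_zero fun j hj => ?_).symm
    have h1 := (sum_eq_zero_iff.1 h0) j (mem_univ j)
    simp only [phi, (mem_filter.1 hj).2, if_true, mul_one] at h1
    rw [h1, mul_zero]
  · exact mul_div_cancel₀ _ h0

/-- Each signal is the label of one bidder, and the maximum over all bidders is at least the value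
for that one. -/
theorem le_welfare (f : I.Scheme) (β : Fin I.m → Fin I.n) (h : ∀ j, (β j : ℕ) = f j) :
    ∑ j, I.v (β j) j * I.p j ≤ welfare f := by
  rw [welfare, ← sum_fiberwise_of_maps_to (t := signals f) (g := f)
    fun j _ => mem_image_of_mem f (mem_univ j)]
  refine sum_le_sum fun S hS => ?_
  obtain ⟨j₀, -, rfl⟩ := mem_image.1 hS
  refine le_trans (le_of_eq ?_)
    (mul_le_mul_right (le_sup (f := fun i => condValue f i (f j₀)) (mem_univ (β j₀))) _)
  rw [signalProb_mul_condValue]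
  refine sum_congr rfl fun j hj => ?_
  have : β j = β j₀ := Fin.ext (by rw [h, h]; exact (mem_filter.1 hj).2)
  rw [this]

theorem exists_welfare_eq (g : I.Scheme) :
    ∃ β : ℕ → Fin I.n, welfare g = ∑ j, I.v (β (g j)) j * I.p j := by
  have hne : (univ : Finset (Fin I.n)).Nonempty := ⟨⟨0, I.n_pos⟩, mem_univ _⟩
  choose β _ hβ using fun S => exists_mem_eq_sup univ hne fun i => condValue g i S
  refine ⟨β, ?_⟩
  rw [welfare, ← sum_fiberwise_of_maps_to (t := signals g) (g := g)
    fun j _ => mem_image_of_mem g (mem_univ j)]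
  refine sum_congr rfl fun S _ => ?_
  rw [hβ, signalProb_mul_condValue]
  refine sum_congr rfl fun j hj => ?_
  rw [(mem_filter.1 hj).2]

/-- The supports of the signals partition the `m` categories into parts of size at least `K`. -/
theorem card_signals_le {g : I.Scheme} (hg : IsKAnonymous g) : (signals g).card ≤ I.m / I.K := by
  rw [Nat.le_div_iff_mul_le I.K_pos]
  have h := card_eq_sum_card_fiberwise (s := univ) (t := signals g) (f := g)
    fun j _ => mem_image_of_mem g (mem_univ j)
  rw [card_univ, Fintype.card_fin] at h
  conv_rhs => rw [h]
  rw [← smul_eq_mul]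
  refine card_nsmul_le_sum _ _ _ fun S hS => ?_
  have := hg S hS
  rwa [support_eq] at this

theorem card_filter_eq_count {m : ℕ} (f : ℕ → ℕ) (S : ℕ) :
    (univ.filter fun j : Fin m => f j = S).card = count f m S := by
  rw [count, card_filter, card_filter, sum_range]

theorem isKAnonymous_of_le_count {f : ℕ → ℕ} (h : ∀ j < I.m, I.K ≤ count f I.m (f j)) :
    IsKAnonymous (I := I) fun j => f j := by
  intro S hS
  obtain ⟨j, -, rfl⟩ := mem_image.1 hS
  rw [support_eq, card_filter_eq_count]
  exact h j j.2

theorem sum_W_le {f : ℕ → ℕ} (h : ∀ j < I.m, f j < I.n) :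
    ((∑ j ∈ range I.m, I.W (f j) j : ℕ) : ℝ) ≤
      commonDen I.input I.m I.n * (welfare (I := I) fun j => f j : ℚ≥0) := by
  have h1 := le_welfare (I := I) (fun j => f j) (fun j => ⟨f j, h j j.2⟩) fun _ => rfl
  have h2 : ((∑ j ∈ range I.m, I.W (f j) j : ℕ) : ℚ≥0) ≤
      commonDen I.input I.m I.n * welfare (I := I) fun j => f j := by
    rw [sum_range, Nat.cast_sum]
    refine le_trans (le_of_eq ?_) (mul_le_mul_right h1 _)
    rw [mul_sum]
    exact sum_congr rfl fun j _ => I.W_eq ⟨f j, h j j.2⟩ j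
  exact_mod_cast h2

/-- `τ` sends a category to a best bidder for its signal, so it uses no more bidders than `g` uses
signals. -/
theorem exists_le_sum_W {g : I.Scheme} (hg : IsKAnonymous g) :
    ∃ τ : ℕ → ℕ, (∀ j < I.m, τ j < I.n) ∧ ((range I.m).image τ).card ≤ I.m / I.K ∧
      commonDen I.input I.m I.n * (welfare g : ℝ) = (∑ j ∈ range I.m, I.W (τ j) j : ℕ) := by
  obtain ⟨β, hβ⟩ := exists_welfare_eq g
  set τ : ℕ → ℕ := fun j => if h : j < I.m then (β (g ⟨j, h⟩) : ℕ) else 0 with hτ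
  have hτj : ∀ j : Fin I.m, τ j = β (g j) := fun j => by simp [hτ]
  refine ⟨τ, fun j hj => ?_, ?_, ?_⟩
  · rw [hτj ⟨j, hj⟩]; exact (β _).2
  · refine le_trans (card_le_card (t := (signals g).image fun S => (β S : ℕ)) fun a ha => ?_)
      (card_image_le.trans (card_signals_le hg))
    obtain ⟨j, hj, rfl⟩ := mem_image.1 ha
    exact mem_image.2 ⟨g ⟨j, mem_range.1 hj⟩, mem_image_of_mem g (mem_univ _),
      (hτj ⟨j, mem_range.1 hj⟩).symm⟩
  · have h : commonDen I.input I.m I.n * welfare g =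
        ((∑ j ∈ range I.m, I.W (τ j) j : ℕ) : ℚ≥0) := by
      rw [sum_range, Nat.cast_sum, hβ, mul_sum]
      refine sum_congr rfl fun j _ => ?_
      rw [hτj, I.W_eq]
    exact_mod_cast h

/-! ### Word length and the final estimate. -/

variable (I)

theorem m_pos : 0 < I.m := lt_of_lt_of_le I.K_pos I.K_le

theorem length_le_size : 3 + 2 * I.m + 2 * (I.n * I.m) ≤ I.size :=
  I.length_encode ▸ length_le_inputSize I.encode

theorem commonDen_lt : commonDen I.input I.m I.n < 2 ^ (2 * I.size) := by
  have hl := I.length_encode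
  rw [two_mul, pow_add]
  exact Nat.mul_lt_mul'' (prod_getD_lt (by omega) (by omega)) (prod_getD_lt (by omega) (by omega))

/-- With `s` the input size, two numerators below `2 ^ s` and a quotient below `2 ^ (2 * s)` give
values of at most `2 ^ (4 * s)`; a sum of `m < 2 ^ s` of them accounts for the fifth `s`. -/
theorem wordLength :
    WordLength (5 * I.size) I.input I.m I.n I.K (commonDen I.input I.m I.n) := by
  have hs := I.length_le_size
  have hn : I.n ≤ I.n * I.m := Nat.le_mul_of_pos_right _ I.m_pos
  refine ⟨I.K_pos, I.K_le, I.n_pos, by omega, by omega, 2 ^ (4 * I.size), fun i _ j _ => ?_, ?_⟩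
  · have h1 : ∀ x, I.input x ≤ 2 ^ I.size := fun x => (getD_lt I.encode x).le
    have h2 := (Nat.div_le_self (commonDen I.input I.m I.n)
      (I.input (3 + 2 * I.m + I.n * I.m + (i * I.m + j)) * I.input (3 + I.m + j))).trans
      I.commonDen_lt.le
    calc intValue I.input I.m I.n (commonDen I.input I.m I.n) i j
        ≤ 2 ^ I.size * 2 ^ I.size * 2 ^ (2 * I.size) :=
          Nat.mul_le_mul (Nat.mul_le_mul (h1 _) (h1 _)) h2
      _ = 2 ^ (4 * I.size) := by ring
  · have h : I.m < 2 ^ I.size := lt_of_le_of_lt (by omega) (Nat.lt_two_pow_self (n := I.size))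
    calc I.m * 2 ^ (4 * I.size) < 2 ^ I.size * 2 ^ (4 * I.size) :=
          Nat.mul_lt_mul_of_pos_right h (Nat.two_pow_pos _)
      _ = _ := by ring

/-- On every random tape the algorithm outputs a `K`-anonymous scheme of sufficient welfare. -/
theorem exists_output (r : List Bool) :
    ∃ f : I.Scheme,
      OutputsInTime mainProg I.encode r (List.ofFn f) (mainProg.time.eval (5 * I.size)) ∧
      IsKAnonymous f ∧ ∀ g : I.Scheme, IsKAnonymous g →
        (welfare g : ℝ) ≤ 2 * Real.exp 1 / (Real.exp 1 - 1) * (welfare f : ℝ) := by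
  have hs := I.length_le_size
  obtain ⟨s', t, hE, ht, -, f, ho, hn, hK, hv⟩ := mainProg_runs I.wordLength (by omega)
    (I.commonDen_lt.trans_le (Nat.pow_le_pow_right (by norm_num) (by omega)))
    (fun x hx => by rw [I.input_p_den ⟨x, hx⟩]; exact NNRat.den_pos _)
    (fun x hx => by rw [I.input_v_den ⟨x, hx⟩]; exact NNRat.den_pos _)
    (bounded_initState I.encode r (show I.size ≤ 5 * I.size by omega)) rfl rfl
    (fun a ha => by funext i; simp [initState, ha]) I.input_zero I.input_one I.input_two
  refine ⟨fun j => f j, ⟨s', t, hE, ?_, ht⟩, isKAnonymous_of_le_count hK, fun g hg => ?_⟩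
  · rw [ho]
    exact List.ext_getElem (by simp) (by simp)
  · obtain ⟨τ, hτ, hc, hw⟩ := exists_le_sum_W hg
    have h1 := hv τ hτ hc
    change (1 - 1 / Real.exp 1) * (∑ j ∈ range I.m, I.W (τ j) j : ℕ) ≤
      2 * (∑ j ∈ range I.m, I.W (f j) j : ℕ) at h1
    have h2 := sum_W_le hn
    rw [← hw] at h1
    have hD : (0 : ℝ) < commonDen I.input I.m I.n := by exact_mod_cast I.commonDen_pos
    have he : (1 : ℝ) < Real.exp 1 := Real.one_lt_exp_iff.2 one_pos
    set wg : ℝ := (welfare g : ℝ)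
    set wf : ℝ := ((welfare (I := I) fun j => f j : ℚ≥0) : ℝ)
    have h3 : (1 - 1 / Real.exp 1) * wg ≤ 2 * wf := by
      refine le_of_mul_le_mul_left ?_ hD
      linarith
    have h4 := mul_le_mul_of_nonneg_left h3 (Real.exp_pos 1).le
    have h5 : Real.exp 1 * ((1 - 1 / Real.exp 1) * wg) = (Real.exp 1 - 1) * wg := by
      field_simp
    rw [div_mul_eq_mul_div, le_div_iff₀ (by linarith)]
    linarith

end SignalingInstance

/-- One program `P` and one polynomial `q`: on every instance `I` and every random tape of
`T = q(size of I)` bits, `P` outputs a `K`-anonymous scheme in time at most `T`, and the optimal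
welfare is at most `2e/(e-1)` times the expected welfare of the output, the expectation being over
`T` independent fair coin tosses. -/
theorem mainTheorem2 :
    ∃ (P : RAM.Prog) (q : Polynomial ℕ), ∀ I : SignalingInstance,
      ∃ f : (Fin (q.eval I.size) → Bool) → I.Scheme,
        (∀ r : Fin (q.eval I.size) → Bool,
          RAM.OutputsInTime P I.encode (List.ofFn r) (List.ofFn (f r)) (q.eval I.size) ∧
          SignalingInstance.IsKAnonymous (f r)) ∧
        ∀ g : I.Scheme, SignalingInstance.IsKAnonymous g →
          (SignalingInstance.welfare g : ℝ) ≤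
            2 * Real.exp 1 / (Real.exp 1 - 1) *
              ((∑ r : Fin (q.eval I.size) → Bool, (SignalingInstance.welfare (f r) : ℝ)) /
                2 ^ (q.eval I.size)) := by
  refine ⟨Signaling.mainProg, Signaling.mainProg.time.comp (5 * Polynomial.X), fun I => ?_⟩
  have hT : (Signaling.mainProg.time.comp (5 * Polynomial.X)).eval I.size =
      Signaling.mainProg.time.eval (5 * I.size) := by
    simp [Polynomial.eval_comp]
  -- The welfare bound holds on each tape separately, so it passes to the average term by term.
  choose f hf hK hw using fun r : Fin ((Signaling.mainProg.time.comp
    (5 * Polynomial.X)).eval I.size) → Bool => I.exists_output (List.ofFn r)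
  refine ⟨f, fun r => ⟨?_, hK r⟩, fun g hg => ?_⟩
  · have h := hf r
    rwa [← hT] at h
  set T := (Signaling.mainProg.time.comp (5 * Polynomial.X)).eval I.size
  rw [← mul_div_assoc, le_div_iff₀ (by positivity), Finset.mul_sum]
  calc (SignalingInstance.welfare g : ℝ) * 2 ^ T
      = ∑ _r : Fin T → Bool, (SignalingInstance.welfare g : ℝ) := by
        simp [mul_comm]
    _ ≤ _ := Finset.sum_le_sum fun r _ => hw r g hg
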